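/- Let $S$ be a finite set and let $P$ be an irreducible, aperiodic transition probability matrix on $S$ with stationary distribution $\pi$. Let $r:S\to\mathbb{R}^d$ be any function and put $\bar r=\sum_{x\in S}\pi_x r(x)$. Poisson's equation $$\bar r=r(x)+\sum_{y\in S}P_{xy}V(y)-V(x)\qquad(x\in S)$$ has a solution $V:S\to\mathbb{R}^d$. For every solution $V$ put $$\Sigma_\infty=\sum_{i,j\in S}\pi_iP_{ij}\bigl(V(j)-(PV)(i)\bigr)\bigl(V(j)-(PV)(i)\bigr)^{T},\qquad (PV)(i)=\sum_{y\in S}P_{iy}V(y).$$ For a Markov chain $(X_k)_{k\ge0}$ with transition matrix $P$ and arbitrary initial distribution let $U_n=\frac1{\sqrt n}\sum_{k=1}^{n}\bigl(r(X_{k-1})-\bar r\bigr)$, and let $Z\sim N(0,I)$ in $\mathbb{R}^d$. Then $$d_{\mathcal W}\bigl(U_n,\Sigma_\infty^{1/2}Z\bigr)=O\Bigl(\frac{\log n}{\sqrt n}\Bigr),$$ that is, there is a constant $C$, depending only on $P$, $\pi$ and $r$ (not on the initial distribution, the choice of $V$, or $n$), such that the left side is at most $C\log n/\sqrt n$ for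 all $n\ge2$. Here $d_{\mathcal W}(X,Y)=\sup_h\,\bigl(E[h(X)]-E[h(Y)]\bigr)$, the supremum being over all $h:\mathbb{R}^d\to\mathbb{R}$ with $|h(x)-h(y)|\le\|x-y\|$ for the Euclidean norm. In particular, let $A:S\to\mathbb{R}^{d\times d}$ and $b:S\to\mathbb{R}^d$ be such that all eigenvalues of $-\bar A$ have strictly negative real parts, where $\bar A=\sum_x\pi_xA(x)$ and $\bar b=\sum_x\pi_xb(x)$. Then there is a unique $\theta^*\in\mathbb{R}^d$ with $\bar A\theta^*+\bar b=0$, and the above holds for $r(x)=A(x)\theta^*+b(x)$. -/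

import Mathlib

open MeasureTheory ProbabilityTheory
open scoped ENNReal Matrix

universe v w

noncomputable section

/-- The Wasserstein distance `sup_{h ∈ Lip₁} (E h(X) - E h(Y))` between the laws `μ` of `X` and `ν`
of `Y`, as an element of `[0, ∞]`. It is meant for laws with a finite first moment, for which every
Lipschitz function is integrable. Since `h = 0` is allowed, replacing the negative differences by
`0` does not change the supremum. -/
def wassersteinDist {E : Type*} [NormedAddCommGroup E] [MeasurableSpace E]
    (μ ν : Measure E) : ℝ≥0∞ :=
  ⨆ (h : E → ℝ) (_ : LipschitzWith 1 h), ENNReal.ofReal ((∫ x, h x ∂μ) - ∫ x, h x ∂ν)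

section MarkovChain

variable {S : Type v} [Fintype S]

/-- Every state has period one: the only common divisor of its possible return times is `1`. -/
def IsAperiodic [DecidableEq S] (P : Matrix S S ℝ) : Prop :=
  ∀ i, ∀ g : ℕ, (∀ n : ℕ, 0 < n → 0 < (P ^ n) i i → g ∣ n) → g = 1

/-- `π` is a stationary probability distribution of the transition matrix `P`. -/
def IsStationaryDistribution (P : Matrix S S ℝ) (π : S → ℝ) : Prop :=
  π ∈ stdSimplex ℝ S ∧ π ᵥ* P = π

/-- The expectation of `f(Y)` for `Y` with distribution `π`. -/
def finMean {E : Type*} [AddCommMonoid E] [Module ℝ E] (π : S → ℝ) (f : S → E) : E :=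
  ∑ x, π x • f x

/-- `X₀, X₁, …` is a time-homogeneous Markov chain with transition matrix `P` under `μ`, with an
arbitrary initial distribution. -/
def IsMarkovChain [MeasurableSpace S] {Ω : Type*} [MeasurableSpace Ω]
    (P : Matrix S S ℝ) (μ : Measure Ω) (X : ℕ → Ω → S) : Prop :=
  (∀ k, Measurable (X k)) ∧
    ∀ (n : ℕ) (x : ℕ → S),
      μ.real {ω | ∀ k ≤ n + 1, X k ω = x k} =
        μ.real {ω | ∀ k ≤ n, X k ω = x k} * P (x n) (x (n + 1))

variable {d : ℕ}

/-- `V` solves Poisson's equation `r̄ = r(x) + E(V(X₁) | X₀ = x) - V(x)`, with `r̄ = E_π r`. -/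
def IsPoissonSolution (P : Matrix S S ℝ) (π : S → ℝ) (r V : S → EuclideanSpace ℝ (Fin d)) :
    Prop :=
  ∀ x, finMean π r = r x + finMean (P x) V - V x

/-- `Σ_∞ = ∑_{i,j} π_i P_{ij} (V(j) - E(V(X₁) | X₀ = i)) (V(j) - E(V(X₁) | X₀ = i))ᵀ`. -/
def asympCov (P : Matrix S S ℝ) (π : S → ℝ) (V : S → EuclideanSpace ℝ (Fin d)) :
    Matrix (Fin d) (Fin d) ℝ :=
  ∑ i, ∑ j, (π i * P i j) •
    Matrix.vecMulVec (V j - finMean (P i) V).ofLp (V j - finMean (P i) V).ofLp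

/-- `U_n = n^{-1/2} ∑_{k=1}^n (r(X_{k-1}) - r̄)`. -/
def normalizedSum {Ω : Type*} (π : S → ℝ) (r : S → EuclideanSpace ℝ (Fin d)) (X : ℕ → Ω → S)
    (n : ℕ) (ω : Ω) : EuclideanSpace ℝ (Fin d) :=
  (√(n : ℝ))⁻¹ • ∑ k ∈ Finset.range n, (r (X k ω) - finMean π r)

/-- Poisson's equation for `r` is solvable, and `d_W(U_n, Σ_∞^{1/2} Z) = O(log n / √n)`, with a
constant that depends neither on the initial distribution of the chain nor on the choice of the
solution `V` in the definition of `Σ_∞`. The measure `multivariateGaussian 0 Σ` is by definition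
the law of `Σ^{1/2} Z` with `Z` standard Gaussian. -/
def HasMarkovCLTRate [MeasurableSpace S] (P : Matrix S S ℝ) (π : S → ℝ)
    (r : S → EuclideanSpace ℝ (Fin d)) : Prop :=
  (∃ V, IsPoissonSolution P π r V) ∧
    ∃ C : ℝ, ∀ V, IsPoissonSolution P π r V →
      ∀ (Ω : Type w) [MeasurableSpace Ω] (μ : Measure Ω) [IsProbabilityMeasure μ] (X : ℕ → Ω → S),
        IsMarkovChain P μ X → ∀ n : ℕ, 2 ≤ n →
          wassersteinDist (μ.map (normalizedSum π r X n))
              (multivariateGaussian 0 (asympCov P π V)) ≤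
            ENNReal.ofReal (C * (Real.log n / √(n : ℝ)))

end MarkovChain

/-- All complex eigenvalues of the real matrix `M` have negative real parts. -/
def IsHurwitz {d : ℕ} (M : Matrix (Fin d) (Fin d) ℝ) : Prop :=
  ∀ z ∈ spectrum ℂ (M.map (algebraMap ℝ ℂ)), z.re < 0

end

/-! ### Gaussian integrals, the Cameron-Martin shift, and Taylor expansion of Gaussian averages -/

section GaussianSmoothing

open scoped RealInnerProductSpace

/-! The proof is a Lindeberg replacement along a martingale, with a corrector for the state
dependence of the conditional covariance. Poisson's equation turns the partial sums, up to the
bounded term V(X_n), into a martingale M_n with increments ξ(X_k, X_{k+1}), where ξ(x, y) = V(y) -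
(PV)(x). With σ = Σ_∞^{1/2} and h 1-Lipschitz, put f_t(m) = E h(m + √t σZ), so that f_{t+1}(m) = E
f_t(m + σZ). While M advances by one step, the Gaussian time t that remains drops by one.

Although h is only Lipschitz, u ↦ f_t(m + σu) has a second-order expansion with error O(‖u‖³/t):
Cameron-Martin moves the shift u from h to the Gaussian density, which is expanded in Hermite
polynomials (`exists_taylor_gaussian`, `exists_taylor_gaussianSmoothing`). Averaged over one chain
step, the linear term vanishes and the quadratic term sees the conditional covariance at x; the
Gaussian step sees its stationary mean. The difference has π-mean zero, so it is g - Pg for some g =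
G (`exists_sub_sum_eq`), and adding ½⟨Hess f_t, G(x)⟩ to f_t cancels it. What remains is O(1/t)
(`exists_correctedSmoothing_step`), because the Hessian varies by O(1/t) under a bounded move in
space or a unit step in time.

Summing over t = 1, …, n gives O(harmonic n) = O(log n) for the unnormalised sum; starting at t = 1
rather than 0 costs O(1). Rescaling by 1/√n gives the rate.

Σ_∞ may be singular, and then f_t is smooth only along the range of σ. This suffices: every ξ(x, y)
with P x y ≠ 0 lies in that range (`apply_eq_of_inner_adjoint_eq`), so ξ = ση with η = Kξ for a
generalised inverse K. The Gaussian step is written as σ(QZ) with Q = Kσ, since QZ, unlike Z, always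
has the averaged covariance of η. -/

theorem integrable_exp_mul_norm_of_isGaussian {E : Type*} [NormedAddCommGroup E] [NormedSpace ℝ E]
    [MeasurableSpace E] [BorelSpace E] [SecondCountableTopology E] [CompleteSpace E]
    (μ : Measure E) [IsGaussian μ] (a : ℝ) : Integrable (fun z => Real.exp (a * ‖z‖)) μ := by
  -- Fernique's theorem; completing the square then gives `a‖z‖ ≤ a²/C + C‖z‖²`.
  obtain ⟨C, hC, hint⟩ := IsGaussian.exists_integrable_exp_sq μ
  refine (hint.const_mul (Real.exp (a ^ 2 / C))).mono' (by fun_prop) (ae_of_all _ fun z => ?_)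
  rw [Real.norm_eq_abs, Real.abs_exp, ← Real.exp_add, Real.exp_le_exp]
  have h : 0 ≤ (a / 2 - C * ‖z‖) ^ 2 / C := by positivity
  have h2 : (a / 2 - C * ‖z‖) ^ 2 / C = a ^ 2 / C / 4 - a * ‖z‖ + C * ‖z‖ ^ 2 := by
    field_simp; ring
  have h3 : 0 ≤ a ^ 2 / C := by positivity
  linarith

theorem integrable_one_add_norm_pow_of_isGaussian {E : Type*} [NormedAddCommGroup E]
    [NormedSpace ℝ E] [MeasurableSpace E] [BorelSpace E] [SecondCountableTopology E]
    [CompleteSpace E] (μ : Measure E) [IsGaussian μ] (k : ℕ) :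
    Integrable (fun z => (1 + ‖z‖) ^ k) μ := by
  refine (integrable_exp_mul_norm_of_isGaussian μ k).mono' (by fun_prop)
    (ae_of_all _ fun z => ?_)
  rw [Real.norm_of_nonneg (by positivity), Real.exp_nat_mul]
  have := Real.add_one_le_exp ‖z‖
  gcongr
  linarith

variable {ι : Type*} [Fintype ι]

theorem integral_cexp_pi_gaussianReal (w : ι → ℂ) :
    ∫ x : ι → ℝ, Complex.exp (∑ i, w i * x i) ∂(Measure.pi fun _ => gaussianReal 0 1) =
      Complex.exp (∑ i, w i ^ 2 / 2) := by
  simp_rw [Complex.exp_sum]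
  rw [integral_fintype_prod_eq_prod (f := fun i (x : ℝ) => Complex.exp (w i * x))]
  refine Finset.prod_congr rfl fun i _ => ?_
  have := complexMGF_id_gaussianReal (μ := 0) (v := 1) (w i)
  simpa [complexMGF] using this

/-- Complex exponents are allowed so that an exponential tilt and a characteristic function can be
treated together. -/
theorem integral_cexp_stdGaussian (w : ι → ℂ) :
    ∫ z, Complex.exp (∑ i, w i * z i) ∂(stdGaussian (EuclideanSpace ℝ ι)) =
      Complex.exp (∑ i, w i ^ 2 / 2) := by
  rw [← map_pi_eq_stdGaussian, integral_map (by fun_prop) (by fun_prop)]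
  exact integral_cexp_pi_gaussianReal w

/-- The **Cameron-Martin formula** for the standard Gaussian measure. -/
theorem map_const_add_stdGaussian (u : EuclideanSpace ℝ ι) :
    (stdGaussian (EuclideanSpace ℝ ι)).map (fun z => u + z) =
      (stdGaussian (EuclideanSpace ℝ ι)).withDensity
        (fun z => ENNReal.ofReal (Real.exp (⟪u, z⟫ - ‖u‖ ^ 2 / 2))) := by
  have hint : Integrable (fun z => Real.exp (⟪u, z⟫ - ‖u‖ ^ 2 / 2))
      (stdGaussian (EuclideanSpace ℝ ι)) := by
    refine (integrable_exp_mul_norm_of_isGaussian _ ‖u‖).mono' (by fun_prop)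
      (ae_of_all _ fun z => ?_)
    rw [Real.norm_eq_abs, Real.abs_exp, Real.exp_le_exp]
    have := real_inner_le_norm u z
    nlinarith [sq_nonneg ‖u‖]
  have : IsFiniteMeasure ((stdGaussian (EuclideanSpace ℝ ι)).withDensity
        (fun z => ENNReal.ofReal (Real.exp (⟪u, z⟫ - ‖u‖ ^ 2 / 2)))) :=
    isFiniteMeasure_withDensity_ofReal hint.2
  have : IsProbabilityMeasure ((stdGaussian (EuclideanSpace ℝ ι)).map (fun z => u + z)) :=
    Measure.isProbabilityMeasure_map (by fun_prop)
  -- The two sides are Gaussian integrals with exponents `i t` and `u + i t`; they agree because (u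
  -- + it)²/2 - u²/2 = iut - t²/2 in each coordinate.
  apply Measure.ext_of_charFun
  ext t
  rw [charFun_apply, charFun_apply, integral_map (by fun_prop) (by fun_prop),
    integral_withDensity_eq_integral_toReal_smul (by fun_prop) (by simp)]
  have h1 : ∀ z : EuclideanSpace ℝ ι, Complex.exp (⟪u + z, t⟫ * Complex.I) =
      Complex.exp (⟪u, t⟫ * Complex.I) * Complex.exp (∑ i, (t i * Complex.I) * z i) := by
    intro z
    rw [← Complex.exp_add, inner_add_left]
    congr 1
    simp only [PiLp.inner_apply, RCLike.inner_apply, conj_trivial, Complex.ofReal_add,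
      Complex.ofReal_sum, Complex.ofReal_mul, add_mul, Finset.sum_mul]
    congr 1
    exact Finset.sum_congr rfl fun i _ => by ring
  have h2 : ∀ z : EuclideanSpace ℝ ι,
      (ENNReal.ofReal (Real.exp (⟪u, z⟫ - ‖u‖ ^ 2 / 2))).toReal •
        Complex.exp (⟪z, t⟫ * Complex.I) =
      Complex.exp (-(‖u‖ ^ 2 / 2 : ℝ)) *
        Complex.exp (∑ i, (u i + t i * Complex.I) * z i) := by
    intro z
    rw [ENNReal.toReal_ofReal (Real.exp_nonneg _), Complex.real_smul, Complex.ofReal_exp,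
      ← Complex.exp_add, ← Complex.exp_add]
    congr 1
    simp only [PiLp.inner_apply, RCLike.inner_apply, conj_trivial, Complex.ofReal_sub,
      Complex.ofReal_sum, Complex.ofReal_mul, add_mul, Finset.sum_mul, Finset.sum_add_distrib]
    rw [show ∀ a b c : ℂ, a - b + c = -b + (a + c) from fun a b c => by ring]
    congr 2
    · exact Finset.sum_congr rfl fun i _ => by ring
    · exact Finset.sum_congr rfl fun i _ => by ring
  simp_rw [h1, h2, integral_const_mul, integral_cexp_stdGaussian, ← Complex.exp_add]
  congr 1
  simp only [PiLp.inner_apply, RCLike.inner_apply, conj_trivial, EuclideanSpace.real_norm_sq_eq,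
    Complex.ofReal_sum, Complex.ofReal_mul, Finset.sum_mul, Complex.ofReal_div, Finset.sum_div,
    Complex.ofReal_pow, ← Finset.sum_neg_distrib, ← Finset.sum_add_distrib, Complex.ofReal_ofNat]
  refine Finset.sum_congr rfl fun i _ => ?_
  ring_nf

theorem integral_add_stdGaussian (g : EuclideanSpace ℝ ι → ℝ) (u : EuclideanSpace ℝ ι) :
    ∫ z, g (u + z) ∂(stdGaussian (EuclideanSpace ℝ ι)) =
      ∫ z, Real.exp (⟪u, z⟫ - ‖u‖ ^ 2 / 2) * g z ∂(stdGaussian (EuclideanSpace ℝ ι)) := by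
  rw [← (measurableEmbedding_addLeft u).integral_map g, map_const_add_stdGaussian,
    integral_withDensity_eq_integral_toReal_smul (by fun_prop) (by simp)]
  simp [Real.exp_nonneg]

theorem integral_inner_stdGaussian (u : EuclideanSpace ℝ ι) :
    ∫ z, ⟪u, z⟫ ∂(stdGaussian (EuclideanSpace ℝ ι)) = 0 :=
  integral_strongDual_stdGaussian (innerSL ℝ u)

theorem integral_inner_mul_inner_stdGaussian (u v : EuclideanSpace ℝ ι) :
    ∫ z, ⟪u, z⟫ * ⟪v, z⟫ ∂(stdGaussian (EuclideanSpace ℝ ι)) = ⟪u, v⟫ := by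
  have h := congrArg (fun B => B u v) (covarianceBilin_stdGaussian (E := EuclideanSpace ℝ ι))
  rw [covarianceBilin_apply_eq_cov IsGaussian.memLp_two_id, covariance] at h
  simp only [integral_inner_stdGaussian, sub_zero] at h
  exact h

theorem integrable_stdGaussian_of_abs_le {φ : EuclideanSpace ℝ ι → ℝ} (hφ : Continuous φ)
    {c : ℝ} {k : ℕ} (h : ∀ z, |φ z| ≤ c * (1 + ‖z‖) ^ k) :
    Integrable φ (stdGaussian (EuclideanSpace ℝ ι)) :=
  ((integrable_one_add_norm_pow_of_isGaussian _ k).const_mul c).mono'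
    hφ.aestronglyMeasurable (ae_of_all _ h)

theorem abs_integral_stdGaussian_le {φ : EuclideanSpace ℝ ι → ℝ}
    {c : ℝ} {k : ℕ} (h : ∀ z, |φ z| ≤ c * (1 + ‖z‖) ^ k) :
    |∫ z, φ z ∂(stdGaussian (EuclideanSpace ℝ ι))| ≤
      c * ∫ z, (1 + ‖z‖) ^ k ∂(stdGaussian (EuclideanSpace ℝ ι)) := by
  rw [← integral_const_mul, ← Real.norm_eq_abs]
  exact norm_integral_le_of_norm_le
    ((integrable_one_add_norm_pow_of_isGaussian _ k).const_mul c) (ae_of_all _ h)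

/-- The Cameron-Martin density generates the Hermite polynomials; this is its expansion to second
order, used with a = ⟪u, z⟫, s = ‖u‖, r = ‖z‖. Expanding in w = a - s²/2 leaves the cubic Taylor
remainder and the surplus -as²/2 + s⁴/8 of w²/2, each at most s³ exp(4r + 1). -/
theorem abs_exp_sub_hermite_le {a s r : ℝ} (hs : 0 ≤ s) (hs1 : s ≤ 1) (hr : 0 ≤ r)
    (ha : |a| ≤ s * r) :
    |Real.exp (a - s ^ 2 / 2) - 1 - a - (a ^ 2 - s ^ 2) / 2| ≤
      2 * s ^ 3 * Real.exp (4 * r + 1) := by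
  have hw : |a - s ^ 2 / 2| ≤ s * (r + 1) := by
    rw [abs_le] at ha ⊢
    constructor <;> nlinarith
  have h1 : |Real.exp (a - s ^ 2 / 2) - (1 + (a - s ^ 2 / 2) + (a - s ^ 2 / 2) ^ 2 / 2)| ≤
      |a - s ^ 2 / 2| ^ 3 * Real.exp |a - s ^ 2 / 2| := by
    have := Complex.norm_exp_sub_sum_le_norm_mul_exp ((a - s ^ 2 / 2 : ℝ) : ℂ) 3
    simp only [Finset.sum_range_succ, Finset.sum_range_zero, Complex.norm_real,
      Real.norm_eq_abs] at this
    refine le_of_eq_of_le ?_ this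
    rw [← Real.norm_eq_abs, ← Complex.norm_real]
    push_cast
    simp
  have h2 : |a - s ^ 2 / 2| ^ 3 * Real.exp |a - s ^ 2 / 2| ≤ s ^ 3 * Real.exp (4 * r + 1) := by
    have hr1 : r + 1 ≤ Real.exp r := Real.add_one_le_exp r
    have hwr : |a - s ^ 2 / 2| ≤ r + 1 := hw.trans (by nlinarith)
    calc |a - s ^ 2 / 2| ^ 3 * Real.exp |a - s ^ 2 / 2|
        ≤ (s * Real.exp r) ^ 3 * Real.exp (r + 1) := by
          have : |a - s ^ 2 / 2| ≤ s * Real.exp r := hw.trans (by gcongr)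
          gcongr
      _ = s ^ 3 * Real.exp (4 * r + 1) := by
          rw [mul_pow, ← Real.exp_nat_mul, mul_assoc, ← Real.exp_add]
          congr 2
          push_cast
          ring
  have h3 : |a * s ^ 2 / 2 - s ^ 4 / 8| ≤ s ^ 3 * Real.exp (4 * r + 1) := by
    have he : r + 1 ≤ Real.exp (4 * r + 1) :=
      le_trans (by linarith) (Real.add_one_le_exp (4 * r + 1))
    have h4 : s ^ 4 ≤ s ^ 3 := pow_le_pow_of_le_one hs hs1 (by norm_num)
    calc |a * s ^ 2 / 2 - s ^ 4 / 8| ≤ |a * s ^ 2 / 2| + |s ^ 4 / 8| := abs_sub _ _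
      _ = |a| * s ^ 2 / 2 + s ^ 4 / 8 := by
          rw [abs_div, abs_mul, abs_of_nonneg (sq_nonneg s), abs_of_nonneg (by positivity :
            0 ≤ s ^ 4 / 8), abs_of_pos (by norm_num : (0 : ℝ) < 2)]
      _ ≤ (s * r) * s ^ 2 / 2 + s ^ 3 / 8 := by gcongr
      _ ≤ s ^ 3 * (r + 1) := by nlinarith [pow_nonneg hs 3, mul_nonneg (pow_nonneg hs 3) hr]
      _ ≤ _ := by gcongr
  calc _ = |(Real.exp (a - s ^ 2 / 2) - (1 + (a - s ^ 2 / 2) + (a - s ^ 2 / 2) ^ 2 / 2))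
        - (a * s ^ 2 / 2 - s ^ 4 / 8)| := by congr 1; ring
    _ ≤ _ := abs_sub _ _
    _ ≤ _ := by linarith

theorem exists_taylor_gaussian_of_zero :
    ∃ C : ℝ, 0 ≤ C ∧ ∀ (κ : ℝ) (g : EuclideanSpace ℝ ι → ℝ), 0 ≤ κ → Continuous g →
      (∀ x y, |g x - g y| ≤ κ * ‖x - y‖) → g 0 = 0 → ∀ u : EuclideanSpace ℝ ι,
      |(∫ z, g (u + z) ∂(stdGaussian (EuclideanSpace ℝ ι))) -
        (∫ z, g z ∂(stdGaussian (EuclideanSpace ℝ ι))) -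
        (∫ z, g z * ⟪u, z⟫ ∂(stdGaussian (EuclideanSpace ℝ ι))) -
        (∫ z, g z * (⟪u, z⟫ ^ 2 - ‖u‖ ^ 2) ∂(stdGaussian (EuclideanSpace ℝ ι))) / 2| ≤
      C * κ * ‖u‖ ^ 3 := by
  set γ := stdGaussian (EuclideanSpace ℝ ι) with hγ
  set I := ∫ z, (1 + ‖z‖) ^ 3 ∂γ with hI
  set J := ∫ z, Real.exp (5 * ‖z‖) ∂γ with hJ
  have hI0 : 0 ≤ I := integral_nonneg fun z => by positivity
  have hJ0 : 0 ≤ J := integral_nonneg fun z => by positivity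
  refine ⟨1 + 2 * I + 2 * Real.exp 1 * J, by positivity, ?_⟩
  intro κ g hκ hg hlip hg0 u
  have hgz : ∀ z, |g z| ≤ κ * ‖z‖ := fun z => by simpa [hg0] using hlip z 0
  have hin : ∀ z, |⟪u, z⟫| ≤ ‖u‖ * ‖z‖ := fun z => abs_real_inner_le_norm u z
  have b1 : ∀ z, |g z * ⟪u, z⟫| ≤ κ * ‖u‖ * (1 + ‖z‖) ^ 3 := by
    intro z
    rw [abs_mul]
    calc |g z| * |⟪u, z⟫| ≤ (κ * ‖z‖) * (‖u‖ * ‖z‖) := by gcongr; exacts [hgz z, hin z]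
      _ = κ * ‖u‖ * ‖z‖ ^ 2 := by ring
      _ ≤ _ := by
        gcongr
        nlinarith [norm_nonneg z, sq_nonneg ‖z‖, pow_nonneg (norm_nonneg z) 3]
  have b2 : ∀ z, |g z * (⟪u, z⟫ ^ 2 - ‖u‖ ^ 2)| ≤ κ * ‖u‖ ^ 2 * (1 + ‖z‖) ^ 3 := by
    intro z
    rw [abs_mul]
    have : |⟪u, z⟫ ^ 2 - ‖u‖ ^ 2| ≤ ‖u‖ ^ 2 * (‖z‖ ^ 2 + 1) := by
      have h1 : ⟪u, z⟫ ^ 2 ≤ (‖u‖ * ‖z‖) ^ 2 := sq_le_sq' (by linarith [(abs_le.1 (hin z)).1])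
        (abs_le.1 (hin z)).2
      rw [abs_le]
      constructor <;> nlinarith [sq_nonneg ⟪u, z⟫, sq_nonneg (‖u‖ * ‖z‖), sq_nonneg ‖u‖]
    calc |g z| * |⟪u, z⟫ ^ 2 - ‖u‖ ^ 2| ≤ (κ * ‖z‖) * (‖u‖ ^ 2 * (‖z‖ ^ 2 + 1)) := by
          gcongr; exact hgz z
      _ = κ * ‖u‖ ^ 2 * (‖z‖ * (‖z‖ ^ 2 + 1)) := by ring
      _ ≤ _ := by
        gcongr
        nlinarith [norm_nonneg z, sq_nonneg ‖z‖, pow_nonneg (norm_nonneg z) 3]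
  have b0 : ∀ z, |g z| ≤ κ * (1 + ‖z‖) ^ 1 := fun z => (hgz z).trans (by gcongr; linarith)
  have i0 : Integrable g γ := integrable_stdGaussian_of_abs_le hg b0
  have i1 : Integrable (fun z => g z * ⟪u, z⟫) γ :=
    integrable_stdGaussian_of_abs_le (by fun_prop) b1
  have i2 : Integrable (fun z => g z * (⟪u, z⟫ ^ 2 - ‖u‖ ^ 2)) γ :=
    integrable_stdGaussian_of_abs_le (by fun_prop) b2
  have iu : Integrable (fun z => g (u + z)) γ := by
    refine integrable_stdGaussian_of_abs_le (c := κ * (1 + ‖u‖)) (k := 1) (by fun_prop)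
      fun z => (hgz _).trans ?_
    rw [mul_assoc]
    gcongr
    have := norm_add_le u z
    nlinarith [norm_nonneg u, norm_nonneg z, mul_nonneg (norm_nonneg u) (norm_nonneg z)]
  -- For small `u` the density is expanded. For large `u` no cancellation is needed, since every
  -- term is at most a constant times κ‖u‖³.
  rcases le_total ‖u‖ 1 with hu | hu
  · have ie : Integrable (fun z => Real.exp (⟪u, z⟫ - ‖u‖ ^ 2 / 2) * g z) γ := by
      refine (integrable_exp_mul_norm_of_isGaussian γ 2).const_mul κ |>.mono' (by fun_prop)
        (ae_of_all _ fun z => ?_)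
      rw [Real.norm_eq_abs, abs_mul, Real.abs_exp]
      have h1 : Real.exp (⟪u, z⟫ - ‖u‖ ^ 2 / 2) ≤ Real.exp ‖z‖ := by
        rw [Real.exp_le_exp]
        nlinarith [(abs_le.1 (hin z)).2, norm_nonneg z, sq_nonneg ‖u‖]
      have h2 : ‖z‖ ≤ Real.exp ‖z‖ := by linarith [Real.add_one_le_exp ‖z‖]
      calc _ ≤ Real.exp ‖z‖ * (κ * Real.exp ‖z‖) := by
            gcongr
            exact (hgz z).trans (by gcongr)
        _ = κ * Real.exp (2 * ‖z‖) := by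
            rw [two_mul, Real.exp_add]; ring
    have i01 : Integrable (fun z => Real.exp (⟪u, z⟫ - ‖u‖ ^ 2 / 2) * g z - g z) γ := ie.sub i0
    have i02 : Integrable (fun z => Real.exp (⟪u, z⟫ - ‖u‖ ^ 2 / 2) * g z - g z -
      g z * ⟪u, z⟫) γ := i01.sub i1
    rw [integral_add_stdGaussian, ← integral_sub ie i0, ← integral_sub i01 i1,
      ← integral_div, ← integral_sub i02 (i2.div_const 2)]
    have hb : ∀ z, ‖Real.exp (⟪u, z⟫ - ‖u‖ ^ 2 / 2) * g z - g z - g z * ⟪u, z⟫ -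
        g z * (⟪u, z⟫ ^ 2 - ‖u‖ ^ 2) / 2‖ ≤
        2 * Real.exp 1 * κ * ‖u‖ ^ 3 * Real.exp (5 * ‖z‖) := by
      intro z
      rw [Real.norm_eq_abs, show Real.exp (⟪u, z⟫ - ‖u‖ ^ 2 / 2) * g z - g z - g z * ⟪u, z⟫ -
        g z * (⟪u, z⟫ ^ 2 - ‖u‖ ^ 2) / 2 = g z * (Real.exp (⟪u, z⟫ - ‖u‖ ^ 2 / 2) - 1 - ⟪u, z⟫ -
        (⟪u, z⟫ ^ 2 - ‖u‖ ^ 2) / 2) by ring, abs_mul]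
      have h2 : ‖z‖ ≤ Real.exp ‖z‖ := by linarith [Real.add_one_le_exp ‖z‖]
      calc _ ≤ (κ * Real.exp ‖z‖) * (2 * ‖u‖ ^ 3 * Real.exp (4 * ‖z‖ + 1)) := by
            gcongr
            · exact (hgz z).trans (by gcongr)
            · exact abs_exp_sub_hermite_le (norm_nonneg _) hu (norm_nonneg _) (hin z)
        _ = _ := by
            rw [Real.exp_add, show 5 * ‖z‖ = ‖z‖ + 4 * ‖z‖ by ring, Real.exp_add]; ring
    have := norm_integral_le_of_norm_le
      ((integrable_exp_mul_norm_of_isGaussian γ 5).const_mul _) (ae_of_all γ hb)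
    rw [integral_const_mul, ← hJ, Real.norm_eq_abs] at this
    refine this.trans ?_
    have h0 : 0 ≤ κ * ‖u‖ ^ 3 := by positivity
    linarith [mul_nonneg h0 hI0]
  · have c1 := abs_integral_stdGaussian_le b1
    have c2 := abs_integral_stdGaussian_le b2
    rw [← hγ, ← hI] at c1 c2
    have c0 : |(∫ z, g (u + z) ∂γ) - ∫ z, g z ∂γ| ≤ κ * ‖u‖ := by
      rw [← integral_sub iu i0, ← Real.norm_eq_abs]
      have := norm_integral_le_of_norm_le_const (μ := γ) (C := κ * ‖u‖)
        (f := fun z => g (u + z) - g z) (ae_of_all _ fun z => by simpa using hlip (u + z) z)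
      rw [Real.norm_eq_abs, probReal_univ, mul_one] at this
      simpa only [Real.norm_eq_abs] using this
    clear_value I J
    have hu1 : ‖u‖ ≤ ‖u‖ ^ 3 := le_self_pow₀ hu (by norm_num)
    have hu2 : ‖u‖ ^ 2 ≤ ‖u‖ ^ 3 := pow_le_pow_right₀ hu (by norm_num)
    have d0 : κ * ‖u‖ ≤ κ * ‖u‖ ^ 3 := mul_le_mul_of_nonneg_left hu1 hκ
    have d1 : κ * ‖u‖ * I ≤ κ * ‖u‖ ^ 3 * I := mul_le_mul_of_nonneg_right d0 hI0
    have d2 : κ * ‖u‖ ^ 2 * I ≤ κ * ‖u‖ ^ 3 * I :=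
      mul_le_mul_of_nonneg_right (mul_le_mul_of_nonneg_left hu2 hκ) hI0
    have d3 : 0 ≤ κ * ‖u‖ ^ 3 * (Real.exp 1 * J) := by positivity
    have d4 : 0 ≤ κ * ‖u‖ ^ 3 * I := by positivity
    rw [abs_le] at c0 c1 c2 ⊢
    constructor <;> linarith

theorem exists_taylor_gaussian :
    ∃ C : ℝ, 0 ≤ C ∧ ∀ (κ : ℝ) (g : EuclideanSpace ℝ ι → ℝ), 0 ≤ κ → Continuous g →
      (∀ x y, |g x - g y| ≤ κ * ‖x - y‖) → ∀ u : EuclideanSpace ℝ ι,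
      |(∫ z, g (u + z) ∂(stdGaussian (EuclideanSpace ℝ ι))) -
        (∫ z, g z ∂(stdGaussian (EuclideanSpace ℝ ι))) -
        (∫ z, g z * ⟪u, z⟫ ∂(stdGaussian (EuclideanSpace ℝ ι))) -
        (∫ z, g z * (⟪u, z⟫ ^ 2 - ‖u‖ ^ 2) ∂(stdGaussian (EuclideanSpace ℝ ι))) / 2| ≤
      C * κ * ‖u‖ ^ 3 := by
  obtain ⟨C, hC, H⟩ := exists_taylor_gaussian_of_zero (ι := ι)
  refine ⟨C, hC, fun κ g hκ hg hlip u => ?_⟩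
  -- A constant drops out of the whole expression: the two zeroth-order terms cancel, and the first
  -- and second Hermite polynomials have mean zero.
  have := H κ (fun z => g z - g 0) hκ (by fun_prop) (by simpa using hlip) (by simp) u
  refine le_of_eq_of_le ?_ this
  have hgz : ∀ z, |g z| ≤ |g 0| + κ * ‖z‖ := fun z => by
    have h1 := hlip z 0
    have h2 := abs_sub_abs_le_abs_sub (g z) (g 0)
    rw [sub_zero] at h1
    linarith
  have hin : ∀ z, |⟪u, z⟫| ≤ ‖u‖ * ‖z‖ := fun z => abs_real_inner_le_norm u z
  have hgz1 : ∀ z, |g z| ≤ (|g 0| + κ) * (1 + ‖z‖) := fun z => (hgz z).trans (by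
    nlinarith [abs_nonneg (g 0), norm_nonneg z, mul_nonneg (abs_nonneg (g 0)) (norm_nonneg z)])
  have i0 : Integrable g (stdGaussian (EuclideanSpace ℝ ι)) :=
    integrable_stdGaussian_of_abs_le (k := 1) hg (by simpa using hgz1)
  have iu : Integrable (fun z => g (u + z)) (stdGaussian (EuclideanSpace ℝ ι)) := by
    refine integrable_stdGaussian_of_abs_le (c := (|g 0| + κ) * (1 + ‖u‖)) (k := 1)
      (by fun_prop) fun z => (hgz1 _).trans ?_
    rw [mul_assoc]
    gcongr
    have := norm_add_le u z
    nlinarith [norm_nonneg u, norm_nonneg z, mul_nonneg (norm_nonneg u) (norm_nonneg z)]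
  have il : Integrable (fun z => ⟪u, z⟫) (stdGaussian (EuclideanSpace ℝ ι)) :=
    integrable_stdGaussian_of_abs_le (c := ‖u‖) (k := 1) (by fun_prop)
      fun z => (hin z).trans (by gcongr; linarith)
  have hsq : ∀ z, |⟪u, z⟫ ^ 2 - ‖u‖ ^ 2| ≤ ‖u‖ ^ 2 * (1 + ‖z‖) ^ 2 := by
    intro z
    have h1 : ⟪u, z⟫ ^ 2 ≤ (‖u‖ * ‖z‖) ^ 2 := sq_le_sq' (by linarith [(abs_le.1 (hin z)).1])
      (abs_le.1 (hin z)).2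
    have h2 : 0 ≤ ‖u‖ ^ 2 * ‖z‖ := by positivity
    rw [abs_le]
    constructor <;> nlinarith [sq_nonneg ⟪u, z⟫, sq_nonneg (‖u‖ * ‖z‖), sq_nonneg ‖u‖]
  have iq : Integrable (fun z => ⟪u, z⟫ ^ 2 - ‖u‖ ^ 2) (stdGaussian (EuclideanSpace ℝ ι)) :=
    integrable_stdGaussian_of_abs_le (by fun_prop) hsq
  have i1 : Integrable (fun z => g z * ⟪u, z⟫) (stdGaussian (EuclideanSpace ℝ ι)) := by
    refine integrable_stdGaussian_of_abs_le (c := (|g 0| + κ) * ‖u‖) (k := 2) (by fun_prop)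
      fun z => ?_
    rw [abs_mul]
    calc |g z| * |⟪u, z⟫| ≤ ((|g 0| + κ) * (1 + ‖z‖)) * (‖u‖ * (1 + ‖z‖)) := by
          gcongr
          · exact hgz1 z
          · exact (hin z).trans (by gcongr; linarith)
      _ = _ := by ring
  have i2 : Integrable (fun z => g z * (⟪u, z⟫ ^ 2 - ‖u‖ ^ 2))
      (stdGaussian (EuclideanSpace ℝ ι)) := by
    refine integrable_stdGaussian_of_abs_le (c := (|g 0| + κ) * ‖u‖ ^ 2) (k := 3) (by fun_prop)
      fun z => ?_
    rw [abs_mul]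
    calc |g z| * _ ≤ ((|g 0| + κ) * (1 + ‖z‖)) * (‖u‖ ^ 2 * (1 + ‖z‖) ^ 2) := by
          gcongr
          · exact hgz1 z
          · exact hsq z
      _ = _ := by ring
  have eq0 : ∫ z, (⟪u, z⟫ ^ 2 - ‖u‖ ^ 2) ∂(stdGaussian (EuclideanSpace ℝ ι)) = 0 := by
    have h := integral_inner_mul_inner_stdGaussian u u
    have iq' : Integrable (fun z => ⟪u, z⟫ ^ 2) (stdGaussian (EuclideanSpace ℝ ι)) := by
      have := iq.add (integrable_const (‖u‖ ^ 2))
      simpa only [Pi.add_def, sub_add_cancel] using this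
    rw [integral_sub iq' (integrable_const _)]
    simp_rw [← pow_two] at h
    rw [h]
    simp
  simp_rw [sub_mul]
  rw [integral_sub iu (integrable_const _), integral_sub i0 (integrable_const _),
    integral_sub i1 (il.const_mul _), integral_sub i2 (iq.const_mul _), integral_const_mul,
    integral_const_mul, eq0, integral_inner_stdGaussian]
  congr 1
  ring

/-- The convolution of `h` with the law of `√t • σ Z`, with `Z` standard Gaussian. -/
noncomputable def gaussianSmoothing (σ : EuclideanSpace ℝ ι →L[ℝ] EuclideanSpace ℝ ι)
    (h : EuclideanSpace ℝ ι → ℝ) (t : ℝ) (x : EuclideanSpace ℝ ι) : ℝ :=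
  ∫ z, h (x + √t • σ z) ∂(stdGaussian (EuclideanSpace ℝ ι))

/-- The Hessian at `0` of `u ↦ gaussianSmoothing σ h t (x + σ u)`. -/
noncomputable def smoothingHessian [DecidableEq ι]
    (σ : EuclideanSpace ℝ ι →L[ℝ] EuclideanSpace ℝ ι)
    (h : EuclideanSpace ℝ ι → ℝ) (t : ℝ) (x : EuclideanSpace ℝ ι) (i j : ι) : ℝ :=
  t⁻¹ * ∫ z, h (x + √t • σ z) * (z i * z j - if i = j then 1 else 0)
    ∂(stdGaussian (EuclideanSpace ℝ ι))

theorem LipschitzWith.abs_sub_le_norm {E : Type*} [NormedAddCommGroup E] {h : E → ℝ}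
    (hh : LipschitzWith 1 h) (x y : E) : |h x - h y| ≤ ‖x - y‖ := by
  simpa [Real.dist_eq, dist_eq_norm] using hh.dist_le_mul x y

theorem EuclideanSpace.abs_apply_le (z : EuclideanSpace ℝ ι) (i : ι) : |z i| ≤ ‖z‖ := by
  simpa using PiLp.norm_apply_le z i

theorem abs_mul_sub_ite_le [DecidableEq ι] (z : EuclideanSpace ℝ ι) (i j : ι) :
    |z i * z j - if i = j then 1 else 0| ≤ (1 + ‖z‖) ^ 2 := by
  have h1 : |z i * z j| ≤ ‖z‖ * ‖z‖ := by
    rw [abs_mul]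
    gcongr <;> exact EuclideanSpace.abs_apply_le _ _
  have h2 : |(if i = j then 1 else 0 : ℝ)| ≤ 1 := by split_ifs <;> simp
  have h3 := abs_sub (z i * z j) (if i = j then 1 else 0)
  nlinarith [norm_nonneg z]

theorem integral_mul_sub_ite_stdGaussian [DecidableEq ι] (i j : ι) :
    ∫ z, (z i * z j - if i = j then 1 else 0) ∂(stdGaussian (EuclideanSpace ℝ ι)) = 0 := by
  have h := integral_inner_mul_inner_stdGaussian (EuclideanSpace.single i (1 : ℝ))
    (EuclideanSpace.single j 1)
  simp only [EuclideanSpace.inner_single_left, map_one, one_mul] at h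
  have hi : Integrable (fun z => z i * z j) (stdGaussian (EuclideanSpace ℝ ι)) := by
    refine integrable_stdGaussian_of_abs_le (c := 1) (k := 2) (by fun_prop) fun z => ?_
    rw [abs_mul]
    have := EuclideanSpace.abs_apply_le z i
    have := EuclideanSpace.abs_apply_le z j
    calc |z i| * |z j| ≤ ‖z‖ * ‖z‖ := by gcongr
      _ ≤ _ := by nlinarith [norm_nonneg z]
  rw [integral_sub hi (integrable_const _), h]
  simp

/-! ### Gaussian smoothing of Lipschitz functions -/

section

variable (σ : EuclideanSpace ℝ ι →L[ℝ] EuclideanSpace ℝ ι) {h : EuclideanSpace ℝ ι → ℝ}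

theorem LipschitzWith.abs_comp_smul_sub_le (hh : LipschitzWith 1 h) (t : ℝ)
    (x z : EuclideanSpace ℝ ι) :
    |h (x + √t • σ z) - h x| ≤ √t * ‖σ‖ * ‖z‖ := by
  have := hh.abs_sub_le_norm (x + √t • σ z) x
  rw [add_sub_cancel_left, norm_smul, Real.norm_of_nonneg (Real.sqrt_nonneg t)] at this
  refine this.trans ?_
  rw [mul_assoc]
  gcongr
  exact σ.le_opNorm z

theorem LipschitzWith.continuous_comp_smul (hh : LipschitzWith 1 h) (t : ℝ)
    (x : EuclideanSpace ℝ ι) : Continuous fun z => h (x + √t • σ z) :=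
  hh.continuous.comp (by fun_prop)

theorem LipschitzWith.integrable_smoothing_mul (hh : LipschitzWith 1 h) (t : ℝ)
    (x : EuclideanSpace ℝ ι) {φ : EuclideanSpace ℝ ι → ℝ} (hφ : Continuous φ) {c : ℝ}
    {k : ℕ} (hφc : ∀ z, |φ z| ≤ c * (1 + ‖z‖) ^ k) :
    Integrable (fun z => h (x + √t • σ z) * φ z) (stdGaussian (EuclideanSpace ℝ ι)) := by
  have hc := hh.continuous_comp_smul σ t x
  refine integrable_stdGaussian_of_abs_le (c := (|h x| + √t * ‖σ‖) * c) (k := 1 + k)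
    (hc.mul hφ) fun z => ?_
  rw [abs_mul]
  have h1 : |h (x + √t • σ z)| ≤ (|h x| + √t * ‖σ‖) * (1 + ‖z‖) := by
    have h2 := hh.abs_comp_smul_sub_le σ t x z
    have h3 := abs_sub_abs_le_abs_sub (h (x + √t • σ z)) (h x)
    have h4 : 0 ≤ √t * ‖σ‖ := by positivity
    nlinarith [mul_nonneg (abs_nonneg (h x)) (norm_nonneg z)]
  calc _ ≤ ((|h x| + √t * ‖σ‖) * (1 + ‖z‖)) * (c * (1 + ‖z‖) ^ k) := by
        gcongr
        exact hφc z
    _ = _ := by ring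

theorem LipschitzWith.integrable_smoothing (hh : LipschitzWith 1 h) (t : ℝ)
    (x : EuclideanSpace ℝ ι) :
    Integrable (fun z => h (x + √t • σ z)) (stdGaussian (EuclideanSpace ℝ ι)) := by
  simpa using hh.integrable_smoothing_mul σ t x (φ := fun _ => 1) (c := 1) (k := 0)
    (by fun_prop) (by simp)

theorem LipschitzWith.integrable_smoothing_hermite [DecidableEq ι] (hh : LipschitzWith 1 h) (t : ℝ)
    (x : EuclideanSpace ℝ ι) (i j : ι) :
    Integrable (fun z => h (x + √t • σ z) * (z i * z j - if i = j then 1 else 0))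
      (stdGaussian (EuclideanSpace ℝ ι)) :=
  hh.integrable_smoothing_mul σ t x (c := 1) (k := 2) (by fun_prop)
    (by simpa using fun z => abs_mul_sub_ite_le z i j)

/-- The Hermite factor has mean zero, so any constant may be subtracted from h. With c = h x, the
Hessian bounds do not depend on the size of h. -/
theorem integral_smoothing_hermite_eq [DecidableEq ι] (hh : LipschitzWith 1 h) (t c : ℝ)
    (x : EuclideanSpace ℝ ι) (i j : ι) :
    ∫ z, h (x + √t • σ z) * (z i * z j - if i = j then 1 else 0)
      ∂(stdGaussian (EuclideanSpace ℝ ι)) =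
    ∫ z, (h (x + √t • σ z) - c) * (z i * z j - if i = j then 1 else 0)
      ∂(stdGaussian (EuclideanSpace ℝ ι)) := by
  simp_rw [sub_mul (h _)]
  rw [integral_sub (hh.integrable_smoothing_hermite σ t x i j), integral_const_mul,
    integral_mul_sub_ite_stdGaussian, mul_zero, sub_zero]
  exact (integrable_stdGaussian_of_abs_le (c := 1) (k := 2) (by fun_prop)
    (by simpa using fun z => abs_mul_sub_ite_le z i j)).const_mul _

theorem abs_gaussianSmoothing_sub_le (hh : LipschitzWith 1 h) (t : ℝ)
    (x y : EuclideanSpace ℝ ι) :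
    |gaussianSmoothing σ h t x - gaussianSmoothing σ h t y| ≤ ‖x - y‖ := by
  rw [gaussianSmoothing, gaussianSmoothing, ← integral_sub (hh.integrable_smoothing σ t x)
    (hh.integrable_smoothing σ t y)]
  have := norm_integral_le_of_norm_le_const (μ := stdGaussian (EuclideanSpace ℝ ι))
    (C := ‖x - y‖) (f := fun z => h (x + √t • σ z) - h (y + √t • σ z)) (ae_of_all _ fun z => by
      simpa using hh.abs_sub_le_norm (x + √t • σ z) (y + √t • σ z))
  rw [probReal_univ, mul_one] at this
  exact this

theorem lipschitzWith_gaussianSmoothing (hh : LipschitzWith 1 h) (t : ℝ) :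
    LipschitzWith 1 (gaussianSmoothing σ h t) :=
  LipschitzWith.of_dist_le_mul fun x y => by
    simpa [Real.dist_eq, dist_eq_norm] using abs_gaussianSmoothing_sub_le σ hh t x y

theorem abs_gaussianSmoothing_sub_self_le (hh : LipschitzWith 1 h) (t : ℝ)
    (x : EuclideanSpace ℝ ι) :
    |gaussianSmoothing σ h t x - h x| ≤
      √t * ‖σ‖ * ∫ z, (1 + ‖z‖) ^ 1 ∂(stdGaussian (EuclideanSpace ℝ ι)) := by
  have : gaussianSmoothing σ h t x - h x =
      ∫ z, (h (x + √t • σ z) - h x) ∂(stdGaussian (EuclideanSpace ℝ ι)) := by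
    rw [integral_sub (hh.integrable_smoothing σ t x) (integrable_const _)]
    simp [gaussianSmoothing]
  rw [this]
  refine abs_integral_stdGaussian_le fun z => (hh.abs_comp_smul_sub_le σ t x z).trans ?_
  gcongr
  simp

theorem map_smul_conv_stdGaussian {t : ℝ} (ht : 0 ≤ t) :
    stdGaussian (EuclideanSpace ℝ ι) ∗ (stdGaussian (EuclideanSpace ℝ ι)).map (√t • ·) =
      (stdGaussian (EuclideanSpace ℝ ι)).map (√(t + 1) • ·) := by
  have : IsProbabilityMeasure ((stdGaussian (EuclideanSpace ℝ ι)).map (√t • ·)) :=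
    Measure.isProbabilityMeasure_map (by fun_prop)
  have : IsProbabilityMeasure ((stdGaussian (EuclideanSpace ℝ ι)).map (√(t + 1) • ·)) :=
    Measure.isProbabilityMeasure_map (by fun_prop)
  apply Measure.ext_of_charFun
  ext u
  rw [charFun_conv, charFun_map_smul, charFun_map_smul, charFun_stdGaussian, charFun_stdGaussian,
    charFun_stdGaussian, ← Complex.exp_add]
  congr 1
  simp only [norm_smul, Real.norm_of_nonneg (Real.sqrt_nonneg _), Complex.ofReal_mul, mul_pow]
  norm_cast
  rw [Real.sq_sqrt ht, Real.sq_sqrt (by positivity)]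
  ring

/-- The semigroup property at unit step: √(t+1) Z has the law of Z + √t Z' with Z' an independent
copy. -/
theorem gaussianSmoothing_add_one (hh : LipschitzWith 1 h) {t : ℝ} (ht : 0 ≤ t)
    (x : EuclideanSpace ℝ ι) :
    gaussianSmoothing σ h (t + 1) x =
      ∫ z, gaussianSmoothing σ h t (x + σ z) ∂(stdGaussian (EuclideanSpace ℝ ι)) := by
  have : IsProbabilityMeasure ((stdGaussian (EuclideanSpace ℝ ι)).map (√t • ·)) :=
    Measure.isProbabilityMeasure_map (by fun_prop)
  have hc : Continuous fun z => h (x + σ z) := hh.continuous.comp (by fun_prop)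
  have h1 : gaussianSmoothing σ h (t + 1) x =
      ∫ z, h (x + σ z) ∂((stdGaussian (EuclideanSpace ℝ ι)).map (√(t + 1) • ·)) := by
    rw [integral_map (by fun_prop) hc.aestronglyMeasurable]
    simp [gaussianSmoothing]
  have hi : Integrable (fun z => h (x + σ z))
      ((stdGaussian (EuclideanSpace ℝ ι)).map (√(t + 1) • ·)) := by
    rw [integrable_map_measure hc.aestronglyMeasurable (by fun_prop)]
    simpa [Function.comp_def] using hh.integrable_smoothing σ (t + 1) x
  rw [h1]
  rw [← map_smul_conv_stdGaussian ht] at hi ⊢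
  rw [integral_conv hi]
  refine integral_congr_ae (ae_of_all _ fun z => ?_)
  simp only
  have hcz : Continuous fun y => h (x + σ (z + y)) := hh.continuous.comp (by fun_prop)
  rw [integral_map (by fun_prop) hcz.aestronglyMeasurable]
  simp [gaussianSmoothing, add_assoc]

end

/-! ### Hessian bounds and second-order expansions of the smoothing -/

section Hessian

variable [DecidableEq ι] (σ : EuclideanSpace ℝ ι →L[ℝ] EuclideanSpace ℝ ι)

/-- Only h depends on the base point, so its Lipschitz bound passes under the integral, and the
prefactor t⁻¹ survives as the rate. -/
theorem abs_smoothingHessian_sub_le {h : EuclideanSpace ℝ ι → ℝ} (hh : LipschitzWith 1 h) {t : ℝ}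
    (ht : 0 ≤ t) (x y : EuclideanSpace ℝ ι) (i j : ι) :
    |smoothingHessian σ h t x i j - smoothingHessian σ h t y i j| ≤
      t⁻¹ * (‖x - y‖ * ∫ z, (1 + ‖z‖) ^ 2 ∂(stdGaussian (EuclideanSpace ℝ ι))) := by
  rw [smoothingHessian, smoothingHessian, ← mul_sub, ← integral_sub
    (hh.integrable_smoothing_hermite σ t x i j) (hh.integrable_smoothing_hermite σ t y i j),
    abs_mul, abs_of_nonneg (inv_nonneg.2 ht)]
  gcongr
  refine abs_integral_stdGaussian_le fun z => ?_
  rw [← sub_mul, abs_mul]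
  gcongr
  · simpa using hh.abs_sub_le_norm (x + √t • σ z) (y + √t • σ z)
  · exact abs_mul_sub_ite_le z i j

theorem abs_integral_smoothing_hermite_le {h : EuclideanSpace ℝ ι → ℝ} (hh : LipschitzWith 1 h)
    (t : ℝ) (x : EuclideanSpace ℝ ι) (i j : ι) :
    |∫ z, h (x + √t • σ z) * (z i * z j - if i = j then 1 else 0)
      ∂(stdGaussian (EuclideanSpace ℝ ι))| ≤
      √t * ‖σ‖ * ∫ z, (1 + ‖z‖) ^ 3 ∂(stdGaussian (EuclideanSpace ℝ ι)) := by
  rw [integral_smoothing_hermite_eq σ hh t (h x)]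
  refine abs_integral_stdGaussian_le fun z => ?_
  rw [abs_mul]
  calc _ ≤ (√t * ‖σ‖ * (1 + ‖z‖)) * (1 + ‖z‖) ^ 2 := by
        gcongr
        · exact (hh.abs_comp_smul_sub_le σ t x z).trans (by gcongr; simp)
        · exact abs_mul_sub_ite_le z i j
    _ = _ := by ring

theorem abs_integral_smoothing_hermite_sub_le {h : EuclideanSpace ℝ ι → ℝ}
    (hh : LipschitzWith 1 h) (s t : ℝ) (x : EuclideanSpace ℝ ι) (i j : ι) :
    |(∫ z, h (x + √s • σ z) * (z i * z j - if i = j then 1 else 0)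
        ∂(stdGaussian (EuclideanSpace ℝ ι))) -
      ∫ z, h (x + √t • σ z) * (z i * z j - if i = j then 1 else 0)
        ∂(stdGaussian (EuclideanSpace ℝ ι))| ≤
      |√s - √t| * ‖σ‖ * ∫ z, (1 + ‖z‖) ^ 3 ∂(stdGaussian (EuclideanSpace ℝ ι)) := by
  rw [← integral_sub (hh.integrable_smoothing_hermite σ s x i j)
    (hh.integrable_smoothing_hermite σ t x i j)]
  refine abs_integral_stdGaussian_le fun z => ?_
  rw [← sub_mul, abs_mul]
  have h1 : |h (x + √s • σ z) - h (x + √t • σ z)| ≤ |√s - √t| * (‖σ‖ * ‖z‖) := by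
    refine (hh.abs_sub_le_norm _ _).trans ?_
    rw [add_sub_add_left_eq_sub, ← sub_smul, norm_smul, Real.norm_eq_abs]
    gcongr
    exact σ.le_opNorm z
  calc _ ≤ (|√s - √t| * (‖σ‖ * (1 + ‖z‖))) * (1 + ‖z‖) ^ 2 := by
        gcongr
        · exact h1.trans (by gcongr; simp)
        · exact abs_mul_sub_ite_le z i j
    _ = _ := by ring

theorem abs_smoothingHessian_le {h : EuclideanSpace ℝ ι → ℝ} (hh : LipschitzWith 1 h) {t : ℝ}
    (ht : 1 ≤ t) (x : EuclideanSpace ℝ ι) (i j : ι) :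
    |smoothingHessian σ h t x i j| ≤
      ‖σ‖ * ∫ z, (1 + ‖z‖) ^ 3 ∂(stdGaussian (EuclideanSpace ℝ ι)) := by
  have ht0 : 0 < t := by linarith
  rw [smoothingHessian, abs_mul, abs_of_pos (inv_pos.2 ht0), inv_mul_le_iff₀ ht0, ← mul_assoc]
  refine (abs_integral_smoothing_hermite_le σ hh t x i j).trans ?_
  have : 0 ≤ ∫ z, (1 + ‖z‖) ^ 3 ∂(stdGaussian (EuclideanSpace ℝ ι)) :=
    integral_nonneg fun z => by positivity
  gcongr
  rw [Real.sqrt_le_left ht0.le]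
  nlinarith

theorem abs_smoothingHessian_add_one_sub_le {h : EuclideanSpace ℝ ι → ℝ} (hh : LipschitzWith 1 h)
    {t : ℝ} (ht : 1 ≤ t) (x : EuclideanSpace ℝ ι) (i j : ι) :
    |smoothingHessian σ h (t + 1) x i j - smoothingHessian σ h t x i j| ≤
      2 * (‖σ‖ * ∫ z, (1 + ‖z‖) ^ 3 ∂(stdGaussian (EuclideanSpace ℝ ι))) / t := by
  have ht0 : 0 < t := by linarith
  have h1 := abs_integral_smoothing_hermite_le σ hh (t + 1) x i j
  have h2 := abs_integral_smoothing_hermite_sub_le σ hh (t + 1) t x i j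
  rw [smoothingHessian, smoothingHessian]
  have hc0 : 0 ≤ ‖σ‖ * ∫ z, (1 + ‖z‖) ^ 3 ∂(stdGaussian (EuclideanSpace ℝ ι)) :=
    mul_nonneg (norm_nonneg _) (integral_nonneg fun z => by positivity)
  rw [mul_assoc] at h1 h2
  generalize ‖σ‖ * ∫ z, (1 + ‖z‖) ^ 3 ∂(stdGaussian (EuclideanSpace ℝ ι)) = c at *
  generalize (∫ z, h (x + √(t + 1) • σ z) * (z i * z j - if i = j then 1 else 0)
    ∂(stdGaussian (EuclideanSpace ℝ ι))) = A at *
  generalize (∫ z, h (x + √t • σ z) * (z i * z j - if i = j then 1 else 0)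
    ∂(stdGaussian (EuclideanSpace ℝ ι))) = B at *
  have hs1 : √(t + 1) ≤ t + 1 := by
    rw [Real.sqrt_le_left (by linarith)]
    nlinarith
  have hs2 : |√(t + 1) - √t| ≤ 1 := by
    have h3 : √t ≤ √(t + 1) := Real.sqrt_le_sqrt (by linarith)
    rw [abs_of_nonneg (by linarith)]
    have h4 : √(t + 1) ≤ √t + 1 := by
      rw [Real.sqrt_le_left (by positivity)]
      nlinarith [Real.sq_sqrt ht0.le, Real.sqrt_nonneg t]
    linarith
  -- The change splits into that of the integral, where |√(t+1) - √t| ≤ 1, and that of the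
  -- prefactor, where t⁻¹ - (t+1)⁻¹ = t⁻¹(t+1)⁻¹ and the integral grows only like √(t+1).
  have e : (t + 1)⁻¹ * A - t⁻¹ * B = t⁻¹ * (A - B) - t⁻¹ * ((t + 1)⁻¹ * A) := by
    field_simp
    ring
  have e1 : |A - B| ≤ c := h2.trans (mul_le_of_le_one_left hc0 hs2)
  have e2 : |(t + 1)⁻¹ * A| ≤ c := by
    rw [abs_mul, abs_of_pos (by positivity : 0 < (t + 1)⁻¹), inv_mul_le_iff₀ (by linarith)]
    exact h1.trans (by gcongr)
  rw [e]
  calc _ ≤ |t⁻¹ * (A - B)| + |t⁻¹ * ((t + 1)⁻¹ * A)| := abs_sub _ _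
    _ = t⁻¹ * |A - B| + t⁻¹ * |(t + 1)⁻¹ * A| := by
      rw [abs_mul, abs_mul t⁻¹, abs_of_pos (inv_pos.2 ht0)]
    _ ≤ t⁻¹ * c + t⁻¹ * c := by gcongr
    _ = _ := by field_simp; ring

theorem exists_taylor_gaussianSmoothing :
    ∃ C : ℝ, 0 ≤ C ∧ ∀ h : EuclideanSpace ℝ ι → ℝ, LipschitzWith 1 h → ∀ t : ℝ, 0 < t →
      ∀ x : EuclideanSpace ℝ ι, ∃ l : ι → ℝ, ∀ u : EuclideanSpace ℝ ι,
        |gaussianSmoothing σ h t (x + σ u) - gaussianSmoothing σ h t x - ∑ i, l i * u i -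
          (∑ i, ∑ j, smoothingHessian σ h t x i j * (u i * u j)) / 2| ≤ C * ‖u‖ ^ 3 / t := by
  obtain ⟨C, hC, H⟩ := exists_taylor_gaussian (ι := ι)
  refine ⟨C * ‖σ‖, by positivity, fun h hh t ht x => ?_⟩
  refine ⟨fun i => (√t)⁻¹ * ∫ z, h (x + √t • σ z) * z i ∂(stdGaussian (EuclideanSpace ℝ ι)),
    fun u => ?_⟩
  have hst : 0 < √t := Real.sqrt_pos.2 ht
  -- The shift σu is √t σ(u/√t). The Lipschitz constant √t‖σ‖ times ‖u/√t‖³ yields the factor 1/t.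
  have key := H (√t * ‖σ‖) (fun z => h (x + √t • σ z)) (by positivity)
    (hh.continuous_comp_smul σ t x) (fun y z => by
      refine (hh.abs_sub_le_norm _ _).trans ?_
      rw [add_sub_add_left_eq_sub, ← smul_sub, ← map_sub, norm_smul,
        Real.norm_of_nonneg hst.le, mul_assoc]
      gcongr
      exact σ.le_opNorm _) ((√t)⁻¹ • u)
  have e0 : ∫ z, h (x + √t • σ ((√t)⁻¹ • u + z)) ∂(stdGaussian (EuclideanSpace ℝ ι)) =
      gaussianSmoothing σ h t (x + σ u) := by
    rw [gaussianSmoothing]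
    refine integral_congr_ae (ae_of_all _ fun z => ?_)
    simp [smul_smul, hst.ne', add_assoc]
  have e1 : ∫ z, h (x + √t • σ z) * ⟪(√t)⁻¹ • u, z⟫ ∂(stdGaussian (EuclideanSpace ℝ ι)) =
      ∑ i, (√t)⁻¹ * (∫ z, h (x + √t • σ z) * z i ∂(stdGaussian (EuclideanSpace ℝ ι))) * u i := by
    simp_rw [mul_right_comm _ (∫ _, _ ∂_), ← integral_const_mul]
    rw [← integral_finsetSum]
    · refine integral_congr_ae (ae_of_all _ fun z => ?_)
      simp only [PiLp.inner_apply, RCLike.inner_apply, conj_trivial, Finset.mul_sum,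
        PiLp.smul_apply, smul_eq_mul]
      exact Finset.sum_congr rfl fun i _ => by ring
    · intro i _
      exact (hh.integrable_smoothing_mul σ t x (c := 1) (k := 1) (by fun_prop) fun z => by
        have := EuclideanSpace.abs_apply_le z i
        simp; linarith).const_mul _
  have e2 : ∫ z, h (x + √t • σ z) * (⟪(√t)⁻¹ • u, z⟫ ^ 2 - ‖(√t)⁻¹ • u‖ ^ 2)
        ∂(stdGaussian (EuclideanSpace ℝ ι)) =
      ∑ i, ∑ j, smoothingHessian σ h t x i j * (u i * u j) := by
    simp_rw [smoothingHessian, mul_right_comm _ (∫ _, _ ∂_), ← integral_const_mul]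
    have hint : ∀ i j, Integrable (fun z => t⁻¹ * (u i * u j) *
        (h (x + √t • σ z) * (z i * z j - if i = j then 1 else 0)))
        (stdGaussian (EuclideanSpace ℝ ι)) := fun i j =>
      (hh.integrable_smoothing_hermite σ t x i j).const_mul _
    simp_rw [← integral_finsetSum _ fun j _ => hint _ j]
    rw [← integral_finsetSum _ fun i _ => integrable_finsetSum _ fun j _ => hint i j]
    refine integral_congr_ae (ae_of_all _ fun z => ?_)
    simp only
    have f1 : ⟪(√t)⁻¹ • u, z⟫ ^ 2 = ∑ i, ∑ j, t⁻¹ * (u i * u j) * (z i * z j) := by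
      rw [real_inner_smul_left, mul_pow, inv_pow, Real.sq_sqrt ht.le, pow_two]
      simp only [PiLp.inner_apply, RCLike.inner_apply, conj_trivial, Finset.sum_mul_sum]
      simp only [Finset.mul_sum]
      exact Finset.sum_congr rfl fun i _ => Finset.sum_congr rfl fun j _ => by ring
    have f2 : ‖(√t)⁻¹ • u‖ ^ 2 = ∑ i, ∑ j, t⁻¹ * (u i * u j) * if i = j then 1 else 0 := by
      rw [norm_smul, Real.norm_of_nonneg (by positivity), mul_pow, inv_pow, Real.sq_sqrt ht.le,
        EuclideanSpace.real_norm_sq_eq, Finset.mul_sum]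
      refine Finset.sum_congr rfl fun i _ => ?_
      simp [pow_two]
    rw [f1, f2]
    simp only [← Finset.sum_sub_distrib, Finset.mul_sum]
    exact Finset.sum_congr rfl fun i _ => Finset.sum_congr rfl fun j _ => by ring
  rw [e0, e1, e2] at key
  refine key.trans (le_of_eq ?_)
  rw [norm_smul, Real.norm_of_nonneg (by positivity)]
  have : √t * √t = t := Real.mul_self_sqrt ht.le
  field_simp
  rw [pow_two, this]
  ring

/-- A discrete heat equation: integrate the Taylor expansion at u = QZ, where σQ = σ. The linear
term has mean zero and the quadratic one gives the covariance QQᵀ. The freedom in Q is needed when σ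
is singular. -/
theorem exists_gaussianSmoothing_add_one_sub
    (Q : EuclideanSpace ℝ ι →L[ℝ] EuclideanSpace ℝ ι) (hQ : ∀ z, σ (Q z) = σ z) :
    ∃ C : ℝ, 0 ≤ C ∧ ∀ h : EuclideanSpace ℝ ι → ℝ, LipschitzWith 1 h → ∀ t : ℝ, 0 < t →
      ∀ x : EuclideanSpace ℝ ι,
        |gaussianSmoothing σ h (t + 1) x - gaussianSmoothing σ h t x -
          (∑ i, ∑ j, smoothingHessian σ h t x i j *
            ⟪Q.adjoint (EuclideanSpace.single i 1), Q.adjoint (EuclideanSpace.single j 1)⟫) / 2| ≤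
          C / t := by
  obtain ⟨C, hC, H⟩ := exists_taylor_gaussianSmoothing σ
  set γ := stdGaussian (EuclideanSpace ℝ ι) with hγ
  have hM0 : 0 ≤ ∫ z, (1 + ‖z‖) ^ 3 ∂γ := integral_nonneg fun z => by positivity
  refine ⟨C * ‖Q‖ ^ 3 * ∫ z, (1 + ‖z‖) ^ 3 ∂γ, by positivity, fun h hh t ht x => ?_⟩
  obtain ⟨l, hl⟩ := H h hh t ht x
  have hQi : ∀ z i, (Q z) i = ⟪Q.adjoint (EuclideanSpace.single i 1), z⟫ := fun z i => by
    rw [ContinuousLinearMap.adjoint_inner_left]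
    simp [EuclideanSpace.inner_single_left]
  have i0 : Integrable (fun z => gaussianSmoothing σ h t (x + σ z)) γ := by
    simpa using (lipschitzWith_gaussianSmoothing σ hh t).integrable_smoothing σ 1 x
  have i1 : ∀ i, Integrable (fun z => l i * (Q z) i) γ := fun i => by
    refine (integrable_stdGaussian_of_abs_le (c := ‖Q‖) (k := 1) (by fun_prop)
      fun z => ?_).const_mul _
    refine (EuclideanSpace.abs_apply_le _ i).trans ((Q.le_opNorm z).trans ?_)
    gcongr
    simp
  have i2 : ∀ i j, Integrable (fun z => (Q z) i * (Q z) j) γ := fun i j => by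
    refine integrable_stdGaussian_of_abs_le (c := ‖Q‖ ^ 2) (k := 2) (by fun_prop) fun z => ?_
    have h1 : ∀ i, |(Q z) i| ≤ ‖Q‖ * (1 + ‖z‖) := fun i =>
      (EuclideanSpace.abs_apply_le _ i).trans ((Q.le_opNorm z).trans (by gcongr; simp))
    rw [abs_mul, ← mul_pow, pow_two]
    gcongr <;> exact h1 _
  have j0 : Integrable (fun z => gaussianSmoothing σ h t (x + σ z) - gaussianSmoothing σ h t x) γ :=
    i0.sub (integrable_const _)
  have j1 : Integrable (fun z => ∑ i, l i * (Q z) i) γ := integrable_finsetSum _ fun i _ => i1 i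
  have j2 : ∀ i, Integrable (fun z => ∑ j, smoothingHessian σ h t x i j * ((Q z) i * (Q z) j)) γ :=
    fun i => integrable_finsetSum _ fun j _ => (i2 i j).const_mul _
  have j3 : Integrable
      (fun z => ∑ i, ∑ j, smoothingHessian σ h t x i j * ((Q z) i * (Q z) j)) γ :=
    integrable_finsetSum _ fun i _ => j2 i
  have j4 : Integrable (fun z => gaussianSmoothing σ h t (x + σ z) - gaussianSmoothing σ h t x -
      ∑ i, l i * (Q z) i) γ := j0.sub j1
  have e : ∫ z, (gaussianSmoothing σ h t (x + σ z) - gaussianSmoothing σ h t x -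
        (∑ i, l i * (Q z) i) -
        (∑ i, ∑ j, smoothingHessian σ h t x i j * ((Q z) i * (Q z) j)) / 2) ∂γ =
      gaussianSmoothing σ h (t + 1) x - gaussianSmoothing σ h t x -
          (∑ i, ∑ j, smoothingHessian σ h t x i j *
            ⟪Q.adjoint (EuclideanSpace.single i 1), Q.adjoint (EuclideanSpace.single j 1)⟫) / 2 := by
    rw [integral_sub j4 (j3.div_const 2), integral_sub j0 j1,
      integral_sub i0 (integrable_const _), ← gaussianSmoothing_add_one σ hh ht.le,
      integral_finsetSum _ fun i _ => i1 i, integral_div, integral_finsetSum _ fun i _ => j2 i]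
    simp_rw [integral_finsetSum _ fun j _ => (i2 _ j).const_mul _, integral_const_mul, hQi, hγ,
      integral_inner_stdGaussian, integral_inner_mul_inner_stdGaussian]
    simp
  rw [← e]
  have hb : ∀ z, |gaussianSmoothing σ h t (x + σ z) - gaussianSmoothing σ h t x -
        (∑ i, l i * (Q z) i) -
        (∑ i, ∑ j, smoothingHessian σ h t x i j * ((Q z) i * (Q z) j)) / 2| ≤
      C * ‖Q‖ ^ 3 / t * (1 + ‖z‖) ^ 3 := by
    intro z
    have := hl (Q z)
    rw [hQ] at this
    refine this.trans ?_
    rw [div_mul_eq_mul_div, mul_assoc, ← mul_pow]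
    gcongr
    exact (Q.le_opNorm z).trans (by gcongr; simp)
  refine (abs_integral_stdGaussian_le hb).trans (le_of_eq ?_)
  ring

end Hessian

end GaussianSmoothing

/-! ### Finite irreducible chains: harmonic functions and Poisson's equation -/

section FiniteChain

variable {S : Type*} [Fintype S] {P : Matrix S S ℝ} {π : S → ℝ}

theorem sum_pow_mul_eq_of_harmonic [DecidableEq S] {f : S → ℝ}
    (hf : ∀ x, ∑ y, P x y * f y = f x) (k : ℕ) (x : S) :
    ∑ y, (P ^ k) x y * f y = f x := by
  have h : P *ᵥ f = f := funext hf
  have hk : ∀ k : ℕ, (P ^ k) *ᵥ f = f := fun k => by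
    induction k with
    | zero => simp
    | succ k ih => rw [pow_succ, ← Matrix.mulVec_mulVec, h, ih]
  exact congrFun (hk k) x

/-- The maximum principle: some power of P charges z from a maximum point m, so f z < f m would pull
the average at m strictly below the maximum. -/
theorem eq_of_harmonic [DecidableEq S]
    (hP : P ∈ Matrix.rowStochastic ℝ S) (hirr : P.IsIrreducible)
    {f : S → ℝ} (hf : ∀ x, ∑ y, P x y * f y = f x) (x y : S) : f x = f y := by
  obtain ⟨m, -, hm⟩ := Finset.exists_max_image Finset.univ f ⟨x, Finset.mem_univ x⟩
  suffices h : ∀ z, f z = f m by rw [h x, h y]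
  intro z
  by_contra hz
  have hlt : f z < f m := lt_of_le_of_ne (hm z (Finset.mem_univ z)) hz
  obtain ⟨k, -, hk⟩ := (Matrix.isIrreducible_iff_exists_pow_pos
    fun i j => Matrix.nonneg_of_mem_rowStochastic hP).1 hirr m z
  have hPk := pow_mem hP k
  have h1 := sum_pow_mul_eq_of_harmonic hf k m
  have h2 : ∑ y, (P ^ k) m y * f y < ∑ y, (P ^ k) m y * f m :=
    Finset.sum_lt_sum (fun y _ => mul_le_mul_of_nonneg_left (hm y (Finset.mem_univ y))
      (Matrix.nonneg_of_mem_rowStochastic hPk)) ⟨z, Finset.mem_univ z, by gcongr⟩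
  rw [h1, ← Finset.sum_mul, Matrix.sum_row_of_mem_rowStochastic hPk, one_mul] at h2
  exact lt_irrefl _ h2

theorem IsStationaryDistribution.sum_mul_eq (hπ : IsStationaryDistribution P π) (y : S) :
    ∑ x, π x * P x y = π y := congrFun hπ.2 y

theorem IsStationaryDistribution.sum_mul_sum_eq (hπ : IsStationaryDistribution P π) (f : S → ℝ) :
    ∑ x, π x * ∑ y, P x y * f y = ∑ x, π x * f x := by
  simp_rw [Finset.mul_sum, ← mul_assoc]
  rw [Finset.sum_comm]
  simp_rw [← Finset.sum_mul, hπ.sum_mul_eq]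

theorem IsStationaryDistribution.pos [DecidableEq S]
    (hP : P ∈ Matrix.rowStochastic ℝ S) (hirr : P.IsIrreducible)
    (hπ : IsStationaryDistribution P π) (y : S) : 0 < π y := by
  have hex : ∃ x, 0 < π x := by
    by_contra! h
    have h1 := hπ.1.2
    have h2 : ∑ x, π x ≤ 0 := Finset.sum_nonpos fun x _ => h x
    linarith
  obtain ⟨x, hx⟩ := hex
  obtain ⟨k, -, hk⟩ := (Matrix.isIrreducible_iff_exists_pow_pos
    fun i j => Matrix.nonneg_of_mem_rowStochastic hP).1 hirr x y
  have hpow : ∀ k : ℕ, π ᵥ* (P ^ k) = π := fun k => by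
    induction k with
    | zero => simp
    | succ k ih => rw [pow_succ, ← Matrix.vecMul_vecMul, ih, hπ.2]
  have h : ∑ z, π z * (P ^ k) z y = π y := congrFun (hpow k) y
  rw [← h]
  exact Finset.sum_pos' (fun z _ => mul_nonneg (hπ.1.1 z)
    (Matrix.nonneg_of_mem_rowStochastic (pow_mem hP k))) ⟨x, Finset.mem_univ x, mul_pos hx hk⟩

/-- I - P becomes invertible after adding the rank-one operator f ↦ π(f)·1. That operator preserves
the π-mean, so an element of its kernel has mean zero and is harmonic, hence constant, hence zero.
For r of mean zero the preimage has mean zero too, and the added term disappears. -/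
theorem exists_sub_sum_eq [DecidableEq S]
    (hP : P ∈ Matrix.rowStochastic ℝ S) (hirr : P.IsIrreducible)
    (hπ : IsStationaryDistribution P π) {r : S → ℝ} (hr : ∑ x, π x * r x = 0) :
    ∃ V : S → ℝ, ∀ x, V x - ∑ y, P x y * V y = r x := by
  let T : (S → ℝ) →ₗ[ℝ] (S → ℝ) :=
    { toFun := fun f x => f x - ∑ y, P x y * f y + ∑ y, π y * f y
      map_add' := fun f g => by
        ext x
        simp only [Pi.add_apply, mul_add, Finset.sum_add_distrib]
        ring
      map_smul' := fun c f => by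
        ext x
        simp only [Pi.smul_apply, smul_eq_mul, RingHom.id_apply, mul_add, mul_sub, Finset.mul_sum,
          mul_left_comm c] }
  have hT : ∀ f x, T f x = f x - ∑ y, P x y * f y + ∑ y, π y * f y := fun f x => rfl
  have hπT : ∀ f, ∑ x, π x * T f x = ∑ y, π y * f y := fun f => by
    simp only [hT, mul_add, mul_sub, Finset.sum_add_distrib, Finset.sum_sub_distrib,
      hπ.sum_mul_sum_eq, ← Finset.sum_mul, hπ.1.2, sub_self, zero_add, one_mul]
  have hinj : Function.Injective T := by
    rw [injective_iff_map_eq_zero]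
    intro f hf
    have h0 : ∑ y, π y * f y = 0 := by
      rw [← hπT, hf]
      simp
    have hharm : ∀ x, ∑ y, P x y * f y = f x := fun x => by
      have := hT f x
      rw [hf, h0, Pi.zero_apply] at this
      linarith
    ext x
    have hc : ∑ y, π y * f y = f x := by
      rw [Finset.sum_congr rfl fun y _ => by rw [eq_of_harmonic hP hirr hharm y x],
        ← Finset.sum_mul, hπ.1.2, one_mul]
    rw [← hc, h0, Pi.zero_apply]
  obtain ⟨V, hV⟩ := LinearMap.injective_iff_surjective.1 hinj r
  refine ⟨V, fun x => ?_⟩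
  have h0 : ∑ y, π y * V y = 0 := by rw [← hπT, hV, hr]
  have := hT V x
  rw [h0, hV] at this
  linarith

variable {d : ℕ}

theorem finMean_apply (p : S → ℝ) (f : S → EuclideanSpace ℝ (Fin d)) (i : Fin d) :
    (finMean p f) i = ∑ x, p x * f x i := by
  simp [finMean]

theorem exists_isPoissonSolution [DecidableEq S]
    (hP : P ∈ Matrix.rowStochastic ℝ S) (hirr : P.IsIrreducible)
    (hπ : IsStationaryDistribution P π) (r : S → EuclideanSpace ℝ (Fin d)) :
    ∃ V, IsPoissonSolution P π r V := by
  have h : ∀ i, ∃ V : S → ℝ, ∀ x, V x - ∑ y, P x y * V y = r x i - finMean π r i := fun i => by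
    refine exists_sub_sum_eq hP hirr hπ ?_
    simp only [mul_sub, Finset.sum_sub_distrib, finMean_apply, ← Finset.sum_mul, hπ.1.2, one_mul,
      sub_self]
  choose V hV using h
  refine ⟨fun x => WithLp.toLp 2 fun i => V i x, fun x => ?_⟩
  ext i
  have := hV i x
  simp only [PiLp.add_apply, PiLp.sub_apply, finMean_apply] at this ⊢
  linarith

/-- The difference of two solutions is harmonic in each coordinate, hence constant, and constants
cancel in a martingale increment. This makes Σ_∞ independent of the solution. -/
theorem IsPoissonSolution.sub_finMean_eq [DecidableEq S]
    (hP : P ∈ Matrix.rowStochastic ℝ S)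
    (hirr : P.IsIrreducible) {r V V' : S → EuclideanSpace ℝ (Fin d)}
    (hV : IsPoissonSolution P π r V) (hV' : IsPoissonSolution P π r V') (x y : S) :
    V y - finMean (P x) V = V' y - finMean (P x) V' := by
  ext i
  have hharm : ∀ x, ∑ y, P x y * (V y i - V' y i) = V x i - V' x i := fun x => by
    have h1 := congrArg (fun v : EuclideanSpace ℝ (Fin d) => v i) (hV x)
    have h2 := congrArg (fun v : EuclideanSpace ℝ (Fin d) => v i) (hV' x)
    simp only [PiLp.add_apply, PiLp.sub_apply, finMean_apply] at h1 h2
    simp only [mul_sub, Finset.sum_sub_distrib]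
    linarith
  have h1 := hharm x
  rw [eq_of_harmonic hP hirr hharm x y] at h1
  simp only [mul_sub, Finset.sum_sub_distrib] at h1
  simp only [PiLp.sub_apply, finMean_apply]
  linarith

theorem IsPoissonSolution.asympCov_eq [DecidableEq S]
    (hP : P ∈ Matrix.rowStochastic ℝ S)
    (hirr : P.IsIrreducible) {r V V' : S → EuclideanSpace ℝ (Fin d)}
    (hV : IsPoissonSolution P π r V) (hV' : IsPoissonSolution P π r V') :
    asympCov P π V = asympCov P π V' := by
  simp_rw [asympCov, hV.sub_finMean_eq hP hirr hV']

theorem dotProduct_asympCov_mulVec (V : S → EuclideanSpace ℝ (Fin d)) (a b : Fin d → ℝ) :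
    a ⬝ᵥ asympCov P π V *ᵥ b = ∑ x, ∑ y, π x * P x y *
      ((a ⬝ᵥ (V y - finMean (P x) V).ofLp) * ((V y - finMean (P x) V).ofLp ⬝ᵥ b)) := by
  simp only [asympCov, Matrix.sum_mulVec, dotProduct_sum, Matrix.smul_mulVec, dotProduct_smul,
    Matrix.vecMulVec_mulVec, smul_eq_mul, MulOpposite.smul_eq_mul_unop,
    MulOpposite.unop_op]

theorem posSemidef_asympCov [DecidableEq S]
    (hP : P ∈ Matrix.rowStochastic ℝ S)
    (hπ : IsStationaryDistribution P π) (V : S → EuclideanSpace ℝ (Fin d)) :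
    (asympCov P π V).PosSemidef := by
  refine Matrix.posSemidef_sum _ fun x _ => Matrix.posSemidef_sum _ fun y _ => ?_
  refine Matrix.PosSemidef.smul ?_ (mul_nonneg (hπ.1.1 x) (Matrix.nonneg_of_mem_rowStochastic hP))
  simpa using Matrix.posSemidef_vecMulVec_self_star (V y - finMean (P x) V).ofLp

end FiniteChain

/-! ### The Markov property in integrated form -/

section Path

variable {S : Type*} [Fintype S] [MeasurableSpace S] [MeasurableSingletonClass S]
  {P : Matrix S S ℝ} {Ω : Type*} [MeasurableSpace Ω] {μ : Measure Ω} {X : ℕ → Ω → S}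

theorem IsMarkovChain.integrable_path [IsFiniteMeasure μ] (hX : IsMarkovChain P μ X) {n : ℕ}
    (φ : (Fin n → S) → ℝ) : Integrable (fun ω => φ fun k => X k ω) μ :=
  (Integrable.of_finite (f := φ)).comp_measurable (measurable_pi_lambda _ fun k => hX.1 k)

theorem integral_comp_eq_sum {α : Type*} [Fintype α] [MeasurableSpace α]
    [MeasurableSingletonClass α] [IsFiniteMeasure μ] {Y : Ω → α} (hY : Measurable Y) (φ : α → ℝ) :
    ∫ ω, φ (Y ω) ∂μ = ∑ a, μ.real {ω | Y ω = a} * φ a := by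
  rw [← integral_map hY.aemeasurable .of_discrete (f := φ), integral_fintype .of_finite]
  refine Finset.sum_congr rfl fun a _ => ?_
  rw [map_measureReal_apply hY (measurableSet_singleton a)]
  rfl

theorem IsMarkovChain.integral_path_succ [IsFiniteMeasure μ] (hX : IsMarkovChain P μ X) (n : ℕ)
    (φ : (Fin (n + 1) → S) → S → ℝ) :
    ∫ ω, φ (fun k => X k ω) (X (n + 1) ω) ∂μ =
      ∫ ω, ∑ y, P (X n ω) y * φ (fun k => X k ω) y ∂μ := by
  have hpath : Measurable fun ω (k : Fin (n + 1)) => X k ω :=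
    measurable_pi_lambda _ fun k => hX.1 k
  have h1 := integral_comp_eq_sum (μ := μ) (hpath.prodMk (hX.1 (n + 1)))
    (fun p => φ p.1 p.2)
  have h2 := integral_comp_eq_sum (μ := μ) hpath
    (fun p => ∑ y, P (p (Fin.last n)) y * φ p y)
  simp only [Fin.val_last] at h2
  rw [h1, h2, Fintype.sum_prod_type]
  refine Finset.sum_congr rfl fun p _ => ?_
  rw [Finset.mul_sum]
  refine Finset.sum_congr rfl fun y _ => ?_
  -- The Markov property is stated for infinite sequences of states; only the first n + 2 entries
  -- matter, so the tail is filled with `y`.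
  let x : ℕ → S := fun k => if h : k < n + 1 then p ⟨k, h⟩ else y
  have hx : ∀ k : Fin (n + 1), x k = p k := fun k => by simp only [x, dif_pos k.2]
  have hy : x (n + 1) = y := by simp [x]
  have hM := hX.2 n x
  have e1 : {ω | ∀ k ≤ n, X k ω = x k} = {ω | (fun k : Fin (n + 1) => X k ω) = p} := by
    ext ω
    simp only [Set.mem_ofPred_eq, funext_iff]
    exact ⟨fun h k => by rw [← hx, h k (Nat.lt_succ_iff.1 k.2)], fun h k hk => by
      rw [h ⟨k, Nat.lt_succ_iff.2 hk⟩, ← hx]⟩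
  have e2 : {ω | ∀ k ≤ n + 1, X k ω = x k} =
      {ω | ((fun k : Fin (n + 1) => X k ω), X (n + 1) ω) = (p, y)} := by
    ext ω
    have := Set.ext_iff.1 e1 ω
    simp only [Set.mem_ofPred_eq, Prod.mk.injEq] at this ⊢
    rw [← this]
    constructor
    · exact fun h => ⟨fun k hk => h k (by omega), by rw [h (n + 1) le_rfl, hy]⟩
    · rintro ⟨h, h'⟩ k hk
      rcases Nat.lt_or_ge n k with hlt | hge
      · obtain rfl : k = n + 1 := by omega
        rw [h', hy]
      · exact h k hge
  rw [e1, e2, hy, show x n = p (Fin.last n) from hx (Fin.last n)] at hM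
  rw [hM]
  ring

end Path

/-! ### The corrected Lindeberg step -/

section Lindeberg

open scoped RealInnerProductSpace

/-- K is a generalised inverse: a linear section of σ over its range, extended to the whole space.
-/
theorem ContinuousLinearMap.exists_apply_apply_apply_eq {E : Type*} [NormedAddCommGroup E]
    [NormedSpace ℝ E] [FiniteDimensional ℝ E] (σ : E →L[ℝ] E) :
    ∃ K : E →L[ℝ] E, ∀ z, σ (K (σ z)) = σ z := by
  obtain ⟨g, hg⟩ := (σ : E →ₗ[ℝ] E).rangeRestrict.exists_rightInverse_of_surjective
    (LinearMap.range_rangeRestrict _)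
  obtain ⟨K, hK⟩ := LinearMap.exists_extend g
  refine ⟨LinearMap.toContinuousLinearMap K, fun z => ?_⟩
  have h1 : K (σ z) = g ((σ : E →ₗ[ℝ] E).rangeRestrict z) :=
    LinearMap.congr_fun hK ((σ : E →ₗ[ℝ] E).rangeRestrict z)
  have h2 : σ (g ((σ : E →ₗ[ℝ] E).rangeRestrict z)) = σ z :=
    congrArg Subtype.val (LinearMap.congr_fun hg ((σ : E →ₗ[ℝ] E).rangeRestrict z))
  rw [LinearMap.coe_toContinuousLinearMap', h1, h2]

variable {ι : Type*} [Fintype ι]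

theorem abs_sum_sum_le {A : ι → ι → ℝ} {c : ℝ} (hA : ∀ i j, |A i j| ≤ c) :
    |∑ i, ∑ j, A i j| ≤ (Fintype.card ι : ℝ) ^ 2 * c := by
  calc |∑ i, ∑ j, A i j| ≤ ∑ i, ∑ j, |A i j| :=
        (Finset.abs_sum_le_sum_abs _ _).trans
          (Finset.sum_le_sum fun i _ => Finset.abs_sum_le_sum_abs _ _)
    _ ≤ ∑ _i : ι, ∑ _j : ι, c := Finset.sum_le_sum fun i _ => Finset.sum_le_sum fun j _ => hA i j
    _ = _ := by simp [pow_two, mul_assoc]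

variable [DecidableEq ι] {S : Type*}

/-- The smoothed test function, corrected to second order by the solution `G` of a Poisson
equation for the conditional covariances. -/
noncomputable def correctedSmoothing (σ : EuclideanSpace ℝ ι →L[ℝ] EuclideanSpace ℝ ι)
    (G : S → ι → ι → ℝ) (h : EuclideanSpace ℝ ι → ℝ) (t : ℝ) (x : S)
    (m : EuclideanSpace ℝ ι) : ℝ :=
  gaussianSmoothing σ h t m + (∑ i, ∑ j, smoothingHessian σ h t m i j * G x i j) / 2

variable [Fintype S]

theorem exists_abs_correctedSmoothing_sub_le
    (σ : EuclideanSpace ℝ ι →L[ℝ] EuclideanSpace ℝ ι) (G : S → ι → ι → ℝ) :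
    ∃ C : ℝ, 0 ≤ C ∧ ∀ h : EuclideanSpace ℝ ι → ℝ, LipschitzWith 1 h → ∀ t : ℝ, 1 ≤ t →
      ∀ x m, |correctedSmoothing σ G h t x m - gaussianSmoothing σ h t m| ≤ C := by
  obtain ⟨B, hB⟩ := Finite.exists_le (fun p : S × ι × ι => |G p.1 p.2.1 p.2.2|)
  have hB' : ∀ x i j, |G x i j| ≤ |B| := fun x i j => (hB (x, i, j)).trans (le_abs_self B)
  have hI : 0 ≤ ∫ z, (1 + ‖z‖) ^ 3 ∂(stdGaussian (EuclideanSpace ℝ ι)) :=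
    integral_nonneg fun z => by positivity
  refine ⟨(Fintype.card ι : ℝ) ^ 2 *
    ((‖σ‖ * ∫ z, (1 + ‖z‖) ^ 3 ∂(stdGaussian (EuclideanSpace ℝ ι))) * |B|) / 2, by positivity,
    fun h hh t ht x m => ?_⟩
  rw [correctedSmoothing, add_sub_cancel_left, abs_div, abs_of_pos (by norm_num : (0 : ℝ) < 2)]
  gcongr
  refine abs_sum_sum_le fun i j => ?_
  rw [abs_mul]
  exact mul_le_mul (abs_smoothingHessian_le σ hh ht m i j) (hB' x i j) (abs_nonneg _)
    (by positivity)

/-- One chain step from Gaussian time t is compared with time t + 1. The second-order terms combine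
to ½ H·(Cov_x η - QQᵀ + PG - G), which vanishes by the Poisson equation `hG`. The four remainders
are the Taylor error of the jump (`R₁`), that of the Gaussian step (`R₂`), and the variation of the
Hessian in space (`R₃`) and in time (`R₄`). -/
theorem exists_correctedSmoothing_step {P : Matrix S S ℝ}
    (hP0 : ∀ x y, 0 ≤ P x y) (hP1 : ∀ x, ∑ y, P x y = 1)
    {σ Q : EuclideanSpace ℝ ι →L[ℝ] EuclideanSpace ℝ ι} (hQ : ∀ z, σ (Q z) = σ z)
    {ξ η : S → S → EuclideanSpace ℝ ι} (hξ : ∀ x y, P x y ≠ 0 → σ (η x y) = ξ x y)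
    (hη : ∀ x i, ∑ y, P x y * η x y i = 0) {G : S → ι → ι → ℝ}
    (hG : ∀ i j x, G x i j - ∑ y, P x y * G y i j = ∑ y, P x y * (η x y i * η x y j) -
      ⟪Q.adjoint (EuclideanSpace.single i 1), Q.adjoint (EuclideanSpace.single j 1)⟫) :
    ∃ C : ℝ, 0 ≤ C ∧ ∀ h : EuclideanSpace ℝ ι → ℝ, LipschitzWith 1 h → ∀ t : ℝ, 1 ≤ t →
      ∀ x m, |∑ y, P x y * correctedSmoothing σ G h t y (m + ξ x y) -
        correctedSmoothing σ G h (t + 1) x m| ≤ C / t := by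
  obtain ⟨C₁, hC₁, H₁⟩ := exists_taylor_gaussianSmoothing σ
  obtain ⟨C₂, hC₂, H₂⟩ := exists_gaussianSmoothing_add_one_sub σ Q hQ
  obtain ⟨B₁, hB₁⟩ := Finite.exists_le (fun p : S × S => ‖η p.1 p.2‖)
  obtain ⟨B₂, hB₂⟩ := Finite.exists_le (fun p : S × S => ‖ξ p.1 p.2‖)
  obtain ⟨B₃, hB₃⟩ := Finite.exists_le (fun p : S × ι × ι => |G p.1 p.2.1 p.2.2|)
  replace hB₁ : ∀ x y, ‖η x y‖ ≤ |B₁| := fun x y => (hB₁ (x, y)).trans (le_abs_self _)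
  replace hB₂ : ∀ x y, ‖ξ x y‖ ≤ |B₂| := fun x y => (hB₂ (x, y)).trans (le_abs_self _)
  replace hB₃ : ∀ x i j, |G x i j| ≤ |B₃| := fun x i j => (hB₃ (x, i, j)).trans (le_abs_self _)
  have hI2 : 0 ≤ ∫ z, (1 + ‖z‖) ^ 2 ∂(stdGaussian (EuclideanSpace ℝ ι)) :=
    integral_nonneg fun z => by positivity
  have hI3 : 0 ≤ ‖σ‖ * ∫ z, (1 + ‖z‖) ^ 3 ∂(stdGaussian (EuclideanSpace ℝ ι)) :=
    mul_nonneg (norm_nonneg _) (integral_nonneg fun z => by positivity)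
  have A₃ := fun {h : EuclideanSpace ℝ ι → ℝ} (hh : LipschitzWith 1 h) {t : ℝ} (ht : 0 ≤ t)
    x y i j => abs_smoothingHessian_sub_le σ hh ht x y i j
  have A₄ := fun {h : EuclideanSpace ℝ ι → ℝ} (hh : LipschitzWith 1 h) {t : ℝ} (ht : 1 ≤ t)
    x i j => abs_smoothingHessian_add_one_sub_le σ hh ht x i j
  generalize (∫ z, (1 + ‖z‖) ^ 2 ∂(stdGaussian (EuclideanSpace ℝ ι))) = I₂ at *
  generalize (‖σ‖ * ∫ z, (1 + ‖z‖) ^ 3 ∂(stdGaussian (EuclideanSpace ℝ ι))) = I₃ at *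
  refine ⟨C₁ * |B₁| ^ 3 + C₂ + (Fintype.card ι : ℝ) ^ 2 * (|B₂| * I₂ * |B₃|) / 2 +
    (Fintype.card ι : ℝ) ^ 2 * (2 * I₃ * |B₃|) / 2, by positivity, fun h hh t ht x m => ?_⟩
  have ht0 : 0 < t := by linarith
  obtain ⟨l, hl⟩ := H₁ h hh t ht0 m
  have h2 := H₂ h hh t ht0 m
  set f := gaussianSmoothing σ h t with hf
  set H := smoothingHessian σ h t with hH
  set q : ι → ι → ℝ := fun i j =>
    ⟪Q.adjoint (EuclideanSpace.single i 1), Q.adjoint (EuclideanSpace.single j 1)⟫ with hq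
  set R₁ : S → ℝ := fun y => f (m + σ (η x y)) - f m - ∑ i, l i * η x y i -
    (∑ i, ∑ j, H m i j * (η x y i * η x y j)) / 2 with hR₁
  set R₂ : ℝ := gaussianSmoothing σ h (t + 1) m - f m - (∑ i, ∑ j, H m i j * q i j) / 2 with hR₂
  set R₃ : S → ℝ := fun y => ∑ i, ∑ j, (H (m + ξ x y) i j - H m i j) * G y i j with hR₃
  set R₄ : ℝ := ∑ i, ∑ j, (smoothingHessian σ h (t + 1) m i j - H m i j) * G x i j with hR₄
  have hsum : ∀ φ : S → ℝ, ∀ c : ℝ, (∀ y, |φ y| ≤ c) → |∑ y, P x y * φ y| ≤ c := by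
    intro φ c hc
    calc |∑ y, P x y * φ y| ≤ ∑ y, |P x y * φ y| := Finset.abs_sum_le_sum_abs _ _
      _ ≤ ∑ y, P x y * c := Finset.sum_le_sum fun y _ => by
        rw [abs_mul, abs_of_nonneg (hP0 x y)]
        exact mul_le_mul_of_nonneg_left (hc y) (hP0 x y)
      _ = c := by rw [← Finset.sum_mul, hP1, one_mul]
  have b₁ : |∑ y, P x y * R₁ y| ≤ C₁ * |B₁| ^ 3 / t := hsum _ _ fun y =>
    (hl (η x y)).trans (by gcongr; exact hB₁ x y)
  have b₃ : |∑ y, P x y * R₃ y| ≤ (Fintype.card ι : ℝ) ^ 2 * (|B₂| * I₂ * |B₃|) / t :=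
    hsum _ _ fun y => by
      rw [mul_div_assoc]
      refine abs_sum_sum_le fun i j => ?_
      rw [abs_mul]
      calc _ ≤ (t⁻¹ * (|B₂| * I₂)) * |B₃| := by
            refine mul_le_mul ((A₃ hh ht0.le (m + ξ x y) m i j).trans ?_) (hB₃ y i j)
              (abs_nonneg _) (by positivity)
            rw [add_sub_cancel_left]
            gcongr
            exact hB₂ x y
        _ = _ := by field_simp
  have b₄ : |R₄| ≤ (Fintype.card ι : ℝ) ^ 2 * (2 * I₃ * |B₃|) / t := by
    rw [mul_div_assoc]
    refine abs_sum_sum_le fun i j => ?_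
    rw [abs_mul]
    calc _ ≤ (2 * I₃ / t) * |B₃| :=
          mul_le_mul (A₄ hh ht m i j) (hB₃ x i j) (abs_nonneg _) (by positivity)
      _ = _ := by ring
  have e₁ : ∑ y, P x y * f (m + ξ x y) =
      f m + (∑ i, ∑ j, H m i j * ∑ y, P x y * (η x y i * η x y j)) / 2 + ∑ y, P x y * R₁ y := by
    have s₀ : ∑ y, P x y * f (m + ξ x y) = ∑ y, P x y * f (m + σ (η x y)) :=
      Finset.sum_congr rfl fun y _ => by
        -- Increments outside the range of σ can occur only on transitions of probability zero,
        -- which carry no weight.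
        by_cases hy : P x y = 0
        · simp [hy]
        · rw [hξ x y hy]
    have s₁ : ∑ y, P x y * ∑ i, l i * η x y i = 0 := by
      simp_rw [Finset.mul_sum, mul_left_comm _ (l _)]
      rw [Finset.sum_comm]
      simp_rw [← Finset.mul_sum, hη]
      simp
    have s₂ : ∑ y, P x y * ((∑ i, ∑ j, H m i j * (η x y i * η x y j)) / 2) =
        (∑ i, ∑ j, H m i j * ∑ y, P x y * (η x y i * η x y j)) / 2 := by
      simp_rw [← mul_div_assoc, Finset.mul_sum, mul_left_comm _ (H _ _ _)]
      rw [← Finset.sum_div, Finset.sum_comm]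
      congr 1
      exact Finset.sum_congr rfl fun i _ => Finset.sum_comm
    simp only [hR₁, mul_sub, Finset.sum_sub_distrib, s₁, s₂, ← Finset.sum_mul, hP1, s₀]
    ring
  have e₃ : ∑ y, P x y * ((∑ i, ∑ j, H (m + ξ x y) i j * G y i j) / 2) =
      (∑ i, ∑ j, H m i j * ∑ y, P x y * G y i j) / 2 + (∑ y, P x y * R₃ y) / 2 := by
    have s₂ : ∑ y, P x y * (∑ i, ∑ j, H m i j * G y i j) =
        ∑ i, ∑ j, H m i j * ∑ y, P x y * G y i j := by
      simp_rw [Finset.mul_sum, mul_left_comm _ (H _ _ _)]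
      rw [Finset.sum_comm]
      exact Finset.sum_congr rfl fun i _ => Finset.sum_comm
    simp only [hR₃, sub_mul, mul_sub, Finset.sum_sub_distrib, s₂]
    simp_rw [← mul_div_assoc]
    rw [← Finset.sum_div]
    ring
  have e₅ : (∑ i, ∑ j, H m i j * ∑ y, P x y * (η x y i * η x y j)) -
      (∑ i, ∑ j, H m i j * q i j) + (∑ i, ∑ j, H m i j * ∑ y, P x y * G y i j) -
      (∑ i, ∑ j, H m i j * G x i j) = 0 := by
    simp_rw [← Finset.sum_sub_distrib, ← Finset.sum_add_distrib, ← Finset.sum_sub_distrib]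
    refine Finset.sum_eq_zero fun i _ => Finset.sum_eq_zero fun j _ => ?_
    linear_combination (-H m i j) * hG i j x
  have e₄ : R₄ = (∑ i, ∑ j, smoothingHessian σ h (t + 1) m i j * G x i j) -
      ∑ i, ∑ j, H m i j * G x i j := by
    simp only [hR₄, sub_mul, Finset.sum_sub_distrib]
  have e : ∑ y, P x y * correctedSmoothing σ G h t y (m + ξ x y) -
      correctedSmoothing σ G h (t + 1) x m =
      ∑ y, P x y * R₁ y - R₂ + (∑ y, P x y * R₃ y) / 2 - R₄ / 2 := by
    simp only [correctedSmoothing, mul_add, Finset.sum_add_distrib, ← hf, ← hH]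
    rw [e₁, e₃, e₄, hR₂]
    linear_combination e₅ / 2
  rw [e]
  have b₂ : |R₂| ≤ C₂ / t := h2
  rw [abs_le] at b₁ b₂ b₃ b₄ ⊢
  have ed : (C₁ * |B₁| ^ 3 + C₂ + (Fintype.card ι : ℝ) ^ 2 * (|B₂| * I₂ * |B₃|) / 2 +
      (Fintype.card ι : ℝ) ^ 2 * (2 * I₃ * |B₃|) / 2) / t = C₁ * |B₁| ^ 3 / t + C₂ / t +
      ((Fintype.card ι : ℝ) ^ 2 * (|B₂| * I₂ * |B₃|) / t) / 2 +
      ((Fintype.card ι : ℝ) ^ 2 * (2 * I₃ * |B₃|) / t) / 2 := by ring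
  rw [ed]
  constructor <;> linarith [b₁.1, b₁.2, b₂.1, b₂.2, b₃.1, b₃.2, b₄.1, b₄.2]

end Lindeberg

/-! ### Telescoping along the martingale and the final rate -/

section MarkovRate

open scoped RealInnerProductSpace MatrixOrder

variable {d : ℕ}

/-- The martingale `V(X_n) + ∑_{k<n} (r(X_k) - r̄)` associated with a solution `V` of
Poisson's equation. -/
noncomputable def poissonMartingale {S Ω : Type*} [Fintype S] (π : S → ℝ)
    (r V : S → EuclideanSpace ℝ (Fin d)) (X : ℕ → Ω → S) (n : ℕ) (ω : Ω) :
    EuclideanSpace ℝ (Fin d) :=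
  V (X n ω) + ∑ k ∈ Finset.range n, (r (X k ω) - finMean π r)

theorem IsPoissonSolution.poissonMartingale_succ {S : Type*} [Fintype S]
    {P : Matrix S S ℝ} {Ω : Type*} {X : ℕ → Ω → S} {π : S → ℝ} {r V : S → EuclideanSpace ℝ (Fin d)}
    (hV : IsPoissonSolution P π r V) (n : ℕ) (ω : Ω) :
    poissonMartingale π r V X (n + 1) ω = poissonMartingale π r V X n ω +
      (V (X (n + 1) ω) - finMean (P (X n ω)) V) := by
  rw [poissonMartingale, poissonMartingale, Finset.sum_range_succ, hV (X n ω)]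
  abel

section Telescoping

variable {S : Type*} [Fintype S] [MeasurableSpace S] [MeasurableSingletonClass S]
  {P : Matrix S S ℝ} {Ω : Type*} [MeasurableSpace Ω] {μ : Measure Ω} {X : ℕ → Ω → S}

theorem IsMarkovChain.integrable_comp_poissonMartingale [IsFiniteMeasure μ]
    (hX : IsMarkovChain P μ X) (π : S → ℝ) (r V : S → EuclideanSpace ℝ (Fin d)) (n : ℕ)
    (F : S → EuclideanSpace ℝ (Fin d) → ℝ) :
    Integrable (fun ω => F (X n ω) (poissonMartingale π r V X n ω)) μ := by
  have := hX.integrable_path (n := n + 1) fun p => F (p (Fin.last n))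
    (V (p (Fin.last n)) + ∑ k : Fin n, (r (p k.castSucc) - finMean π r))
  simpa only [poissonMartingale, Finset.sum_range, Fin.val_last, Fin.val_castSucc] using this

theorem IsMarkovChain.integral_poissonMartingale_succ [IsFiniteMeasure μ]
    (hX : IsMarkovChain P μ X) {π : S → ℝ} {r V : S → EuclideanSpace ℝ (Fin d)}
    (hV : IsPoissonSolution P π r V) (n : ℕ) (F : S → EuclideanSpace ℝ (Fin d) → ℝ) :
    ∫ ω, F (X (n + 1) ω) (poissonMartingale π r V X (n + 1) ω) ∂μ =
      ∫ ω, ∑ y, P (X n ω) y * F y (poissonMartingale π r V X n ω +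
        (V y - finMean (P (X n ω)) V)) ∂μ := by
  have := hX.integral_path_succ n fun p y => F y
    (V (p (Fin.last n)) + ∑ k : Fin n, (r (p k.castSucc) - finMean π r) +
      (V y - finMean (P (p (Fin.last n))) V))
  simp_rw [hV.poissonMartingale_succ]
  simpa only [poissonMartingale, Finset.sum_range, Fin.val_last, Fin.val_castSucc] using this

/-- Telescoping: from time k to k + j the chain advances while the parameter of Ψ falls from j + 1
to 1, and the step errors C/j, …, C/1 add up to a harmonic number. -/
theorem IsMarkovChain.abs_integral_sub_integral_le_harmonic [IsProbabilityMeasure μ]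
    (hX : IsMarkovChain P μ X) {π : S → ℝ} {r V : S → EuclideanSpace ℝ (Fin d)}
    (hV : IsPoissonSolution P π r V) {C : ℝ} {Ψ : ℝ → S → EuclideanSpace ℝ (Fin d) → ℝ}
    (hΨ : ∀ t : ℝ, 1 ≤ t → ∀ x m, |∑ y, P x y * Ψ t y (m + (V y - finMean (P x) V)) -
      Ψ (t + 1) x m| ≤ C / t) (j : ℕ) :
    ∀ k, |∫ ω, Ψ 1 (X (k + j) ω) (poissonMartingale π r V X (k + j) ω) ∂μ -
      ∫ ω, Ψ (j + 1) (X k ω) (poissonMartingale π r V X k ω) ∂μ| ≤ C * (harmonic j : ℝ) := by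
  induction j with
  | zero => intro k; simp
  | succ j ih =>
    intro k
    have h1 := ih (k + 1)
    have h2 : |∫ ω, Ψ (j + 1) (X (k + 1) ω) (poissonMartingale π r V X (k + 1) ω) ∂μ -
        ∫ ω, Ψ ((j + 1 : ℕ) + 1) (X k ω) (poissonMartingale π r V X k ω) ∂μ| ≤ C / (j + 1) := by
      rw [hX.integral_poissonMartingale_succ hV k (Ψ (j + 1)), ← integral_sub
        (hX.integrable_comp_poissonMartingale π r V k fun x m =>
          ∑ y, P x y * Ψ (j + 1) y (m + (V y - finMean (P x) V)))
        (hX.integrable_comp_poissonMartingale π r V k (Ψ ((j + 1 : ℕ) + 1)))]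
      have := norm_integral_le_of_norm_le_const (μ := μ) (C := C / (j + 1))
        (f := fun ω => ∑ y, P (X k ω) y * Ψ (j + 1) y (poissonMartingale π r V X k ω +
          (V y - finMean (P (X k ω)) V)) -
          Ψ ((j + 1 : ℕ) + 1) (X k ω) (poissonMartingale π r V X k ω))
        (ae_of_all _ fun ω => by
          push_cast
          exact hΨ (j + 1) (by simp) _ _)
      rw [probReal_univ, mul_one] at this
      exact this
    rw [harmonic_succ]
    push_cast at h1 h2 ⊢
    rw [show k + (j + 1) = k + 1 + j by ring]
    calc _ ≤ _ := abs_sub_le _ _ _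
      _ ≤ _ := add_le_add h1 h2
      _ = _ := by ring

end Telescoping

variable {S : Type v} [Fintype S] {P : Matrix S S ℝ} {π : S → ℝ}

/-- The root is self-adjoint and squares to Σ_∞, so the left side is the form aᵀΣ_∞b. -/
theorem inner_adjoint_sqrt_asympCov [DecidableEq S] (hP : P ∈ Matrix.rowStochastic ℝ S)
    (hπ : IsStationaryDistribution P π) (V : S → EuclideanSpace ℝ (Fin d))
    (a b : EuclideanSpace ℝ (Fin d)) :
    ⟪(Matrix.toEuclideanCLM (𝕜 := ℝ) (CFC.sqrt (asympCov P π V))).adjoint a,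
      (Matrix.toEuclideanCLM (𝕜 := ℝ) (CFC.sqrt (asympCov P π V))).adjoint b⟫ =
    ∑ x, ∑ y, π x * P x y * (⟪a, V y - finMean (P x) V⟫ * ⟪V y - finMean (P x) V, b⟫) := by
  have hS := posSemidef_asympCov hP hπ V
  have hmul : CFC.sqrt (asympCov P π V) * CFC.sqrt (asympCov P π V) = asympCov P π V :=
    CFC.sqrt_mul_sqrt_self _ hS.nonneg
  have hsa : IsSelfAdjoint (CFC.sqrt (asympCov P π V)) :=
    (CFC.sqrt_nonneg (asympCov P π V)).isSelfAdjoint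
  have hsa' : IsSelfAdjoint (Matrix.toEuclideanCLM (𝕜 := ℝ) (CFC.sqrt (asympCov P π V))) :=
    hsa.map _
  rw [ContinuousLinearMap.adjoint_inner_left, hsa'.adjoint_eq, ← ContinuousLinearMap.comp_apply,
    ← ContinuousLinearMap.mul_def, ← map_mul, hmul, Matrix.inner_toEuclideanCLM,
    dotProduct_asympCov_mulVec]
  simp only [EuclideanSpace.inner_eq_star_dotProduct, star_trivial]
  refine Finset.sum_congr rfl fun x _ => Finset.sum_congr rfl fun y _ => ?_
  rw [dotProduct_comm a.ofLp, dotProduct_comm _ b.ofLp]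

/-- If u is orthogonal to the range of σ, then σ*u = 0, so ∑ π_x P_xy ⟪u, ξ x y⟫² = 0 and every term
vanishes. As π > 0, each ξ x y with P x y ≠ 0 is orthogonal to all such u, hence lies in the range.
-/
theorem apply_eq_of_inner_adjoint_eq {E : Type*} [NormedAddCommGroup E] [InnerProductSpace ℝ E]
    [FiniteDimensional ℝ E] {σ K : E →L[ℝ] E} (hK : ∀ z, σ (K (σ z)) = σ z)
    (hP0 : ∀ x y, 0 ≤ P x y) (hπ : ∀ x, 0 < π x) {ξ : S → S → E}
    (hσ : ∀ a b, ⟪σ.adjoint a, σ.adjoint b⟫ =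
      ∑ x, ∑ y, π x * P x y * (⟪a, ξ x y⟫ * ⟪ξ x y, b⟫)) {x y : S} (hxy : P x y ≠ 0) :
    σ (K (ξ x y)) = ξ x y := by
  suffices h : ξ x y ∈ (σ : E →ₗ[ℝ] E).range by
    obtain ⟨w, hw⟩ := h
    rw [← hw]
    exact hK w
  rw [← Submodule.orthogonal_orthogonal (σ : E →ₗ[ℝ] E).range, Submodule.mem_orthogonal]
  intro u hu
  have hadj : σ.adjoint u = 0 := by
    refine ext_inner_left ℝ fun w => ?_
    rw [ContinuousLinearMap.adjoint_inner_right, inner_zero_right]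
    exact (Submodule.mem_orthogonal _ _).1 hu (σ w) ⟨w, rfl⟩
  have h0 := hσ u u
  rw [hadj, inner_zero_left] at h0
  have hnn : ∀ x y, 0 ≤ π x * P x y * (⟪u, ξ x y⟫ * ⟪ξ x y, u⟫) := fun x y => by
    rw [real_inner_comm]
    exact mul_nonneg (mul_nonneg (hπ x).le (hP0 x y)) (mul_self_nonneg _)
  have h1 := (Finset.sum_eq_zero_iff_of_nonneg fun x _ =>
    Finset.sum_nonneg fun y _ => hnn x y).1 h0.symm x (Finset.mem_univ x)
  have h2 := (Finset.sum_eq_zero_iff_of_nonneg fun y _ => hnn x y).1 h1 y (Finset.mem_univ y)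
  rw [real_inner_comm, mul_eq_zero, mul_eq_zero, mul_self_eq_zero] at h2
  rcases h2 with (h2 | h2) | h2
  · exact absurd h2 (hπ x).ne'
  · exact absurd h2 hxy
  · rwa [real_inner_comm]

theorem exists_abs_integral_sub_le_harmonic [DecidableEq S] [MeasurableSpace S]
    [MeasurableSingletonClass S] (hP : P ∈ Matrix.rowStochastic ℝ S) (hirr : P.IsIrreducible)
    (hπ : IsStationaryDistribution P π) {r V : S → EuclideanSpace ℝ (Fin d)}
    (hV : IsPoissonSolution P π r V) :
    ∃ A C : ℝ, 0 ≤ A ∧ 0 ≤ C ∧ ∀ (Ω : Type w) [MeasurableSpace Ω] (μ : Measure Ω)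
      [IsProbabilityMeasure μ] (X : ℕ → Ω → S), IsMarkovChain P μ X → ∀ n : ℕ, 1 ≤ n →
        ∀ h : EuclideanSpace ℝ (Fin d) → ℝ, LipschitzWith 1 h →
          |∫ ω, h (∑ k ∈ Finset.range n, (r (X k ω) - finMean π r)) ∂μ -
            ∫ z, h (√(n : ℝ) • Matrix.toEuclideanCLM (𝕜 := ℝ) (CFC.sqrt (asympCov P π V)) z)
              ∂(stdGaussian (EuclideanSpace ℝ (Fin d)))| ≤ A + C * (harmonic n : ℝ) := by
  set σ := Matrix.toEuclideanCLM (𝕜 := ℝ) (CFC.sqrt (asympCov P π V)) with hσdef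
  have hP0 : ∀ x y, 0 ≤ P x y := fun x y => Matrix.nonneg_of_mem_rowStochastic hP
  have hP1 : ∀ x, ∑ y, P x y = 1 := fun x => Matrix.sum_row_of_mem_rowStochastic hP x
  have hσ := inner_adjoint_sqrt_asympCov hP hπ V
  rw [← hσdef] at hσ
  obtain ⟨K, hK⟩ := σ.exists_apply_apply_apply_eq
  let ξ : S → S → EuclideanSpace ℝ (Fin d) := fun x y => V y - finMean (P x) V
  let η : S → S → EuclideanSpace ℝ (Fin d) := fun x y => K (ξ x y)
  have hξ : ∀ x y, P x y ≠ 0 → σ (η x y) = ξ x y := fun x y hxy =>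
    apply_eq_of_inner_adjoint_eq hK hP0 (hπ.pos hP hirr) hσ hxy
  have hη : ∀ x i, ∑ y, P x y * η x y i = 0 := fun x i => by
    have h1 : ∑ y, P x y • ξ x y = 0 := by
      simp only [ξ, smul_sub, Finset.sum_sub_distrib, ← Finset.sum_smul, hP1, one_smul]
      exact sub_self _
    have h2 := congrArg (fun v : EuclideanSpace ℝ (Fin d) => v i) (congrArg K h1)
    simpa [η] using h2
  let q : Fin d → Fin d → ℝ := fun i j =>
    ⟪(K ∘L σ).adjoint (EuclideanSpace.single i 1), (K ∘L σ).adjoint (EuclideanSpace.single j 1)⟫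
  -- The averaged covariance of η = Kξ is KΣ_∞K*, the covariance of KσZ; this centring makes the
  -- Poisson equation for `G` solvable.
  have hq : ∀ i j, ∑ x, π x * (∑ y, P x y * (η x y i * η x y j)) = q i j := fun i j => by
    simp only [q, ContinuousLinearMap.adjoint_comp, ContinuousLinearMap.comp_apply, hσ,
      Finset.mul_sum]
    refine Finset.sum_congr rfl fun x _ => Finset.sum_congr rfl fun y _ => ?_
    rw [ContinuousLinearMap.adjoint_inner_left, ContinuousLinearMap.adjoint_inner_right,
      EuclideanSpace.inner_single_left, EuclideanSpace.inner_single_right]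
    simp [η, ξ, mul_assoc]
  have hG : ∀ i j, ∃ G : S → ℝ, ∀ x, G x - ∑ y, P x y * G y =
      ∑ y, P x y * (η x y i * η x y j) - q i j := fun i j => by
    refine exists_sub_sum_eq hP hirr hπ ?_
    simp only [mul_sub, Finset.sum_sub_distrib, hq, ← Finset.sum_mul, hπ.1.2, one_mul, sub_self]
  choose G hG using hG
  obtain ⟨C, hC, hstep⟩ := exists_correctedSmoothing_step (Q := K ∘L σ) hP0 hP1 hK hξ hη
    (G := fun x i j => G i j x) hG
  obtain ⟨A, hA, hcor⟩ := exists_abs_correctedSmoothing_sub_le σ fun x i j => G i j x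
  obtain ⟨B, hB⟩ := Finite.exists_le fun x => ‖V x‖
  have hB' : ∀ x, ‖V x‖ ≤ |B| := fun x => (hB x).trans (le_abs_self B)
  have hI : 0 ≤ ‖σ‖ * ∫ z, (1 + ‖z‖) ^ 1 ∂(stdGaussian (EuclideanSpace ℝ (Fin d))) :=
    mul_nonneg (norm_nonneg _) (integral_nonneg fun z => by positivity)
  have hself : ∀ g : EuclideanSpace ℝ (Fin d) → ℝ, LipschitzWith 1 g → ∀ x,
      |gaussianSmoothing σ g 1 x - g x| ≤
        ‖σ‖ * ∫ z, (1 + ‖z‖) ^ 1 ∂(stdGaussian (EuclideanSpace ℝ (Fin d))) := fun g hg x => by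
    simpa using abs_gaussianSmoothing_sub_self_le σ hg 1 x
  generalize (‖σ‖ * ∫ z, (1 + ‖z‖) ^ 1 ∂(stdGaussian (EuclideanSpace ℝ (Fin d)))) = I at *
  -- At each end of the telescope the cost is bounded: `|B|` for the V-term, `I` for one unit of
  -- smoothing, `A` for the corrector.
  refine ⟨|B| + (I + A) + (A + I + |B|), C, by positivity, hC, ?_⟩
  intro Ω _ μ _ X hX n hn h hh
  have hbound : ∀ (φ : Ω → ℝ) (c : ℝ), (∀ ω, |φ ω| ≤ c) → |∫ ω, φ ω ∂μ| ≤ c := by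
    intro φ c hφ
    have := norm_integral_le_of_norm_le_const (μ := μ) (f := φ) (ae_of_all _ hφ)
    rwa [probReal_univ, mul_one] at this
  let Ψ : ℝ → S → EuclideanSpace ℝ (Fin d) → ℝ := correctedSmoothing σ (fun x i j => G i j x) h
  let M := poissonMartingale π r V X
  have hint : ∀ (F : S → EuclideanSpace ℝ (Fin d) → ℝ) k,
      Integrable (fun ω => F (X k ω) (M k ω)) μ := fun F k =>
    hX.integrable_comp_poissonMartingale π r V k F
  have hsum : ∀ ω, ∑ k ∈ Finset.range n, (r (X k ω) - finMean π r) = M n ω - V (X n ω) :=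
    fun ω => by simp [M, poissonMartingale]
  have hM0 : ∀ ω, M 0 ω = V (X 0 ω) := fun ω => by simp [M, poissonMartingale]
  have t1 : |∫ ω, h (M n ω - V (X n ω)) ∂μ - ∫ ω, Ψ 1 (X n ω) (M n ω) ∂μ| ≤ |B| + (I + A) := by
    rw [← integral_sub (hint (fun x m => h (m - V x)) n) (hint (Ψ 1) n)]
    refine hbound _ _ fun ω => ?_
    have a1 := (hh.abs_sub_le_norm (M n ω - V (X n ω)) (M n ω)).trans_eq
      (by rw [sub_sub_cancel_left, norm_neg])
    have a2 := hself h hh (M n ω)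
    have a3 := hcor h hh 1 le_rfl (X n ω) (M n ω)
    have a4 := hB' (X n ω)
    rw [abs_le] at a1 a2 a3 ⊢
    constructor <;> linarith [a1.1, a1.2, a2.1, a2.2, a3.1, a3.2]
  have t2 := hX.abs_integral_sub_integral_le_harmonic hV (Ψ := Ψ)
    (fun t ht x m => hstep h hh t ht x m) n 0
  rw [zero_add] at t2
  -- Telescoping stops at parameter 1, so it starts from n + 1; the extra unit of Gaussian time is
  -- removed by viewing f_{n+1} as the unit smoothing of f_n.
  have t3 : |∫ ω, Ψ (n + 1) (X 0 ω) (M 0 ω) ∂μ - gaussianSmoothing σ h n 0| ≤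
      A + I + |B| := by
    have e : ∫ ω, Ψ (n + 1) (X 0 ω) (M 0 ω) ∂μ - gaussianSmoothing σ h n 0 =
        ∫ ω, (Ψ (n + 1) (X 0 ω) (M 0 ω) - gaussianSmoothing σ h n 0) ∂μ := by
      rw [integral_sub (hint (Ψ (n + 1)) 0) (integrable_const _)]
      simp
    rw [e]
    refine hbound _ _ fun ω => ?_
    have a1 := abs_gaussianSmoothing_sub_le σ hh n (M 0 ω) 0
    have a2 := hself _ (lipschitzWith_gaussianSmoothing σ hh n) (M 0 ω)
    have a5 : gaussianSmoothing σ (gaussianSmoothing σ h n) 1 (M 0 ω) =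
        gaussianSmoothing σ h (n + 1) (M 0 ω) := by
      rw [gaussianSmoothing_add_one σ hh (Nat.cast_nonneg n)]
      simp [gaussianSmoothing]
    rw [a5] at a2
    have a3 := hcor h hh (n + 1) (by simp) (X 0 ω) (M 0 ω)
    have a4 := hB' (X 0 ω)
    rw [sub_zero, hM0] at a1
    rw [hM0] at a2 a3 ⊢
    rw [abs_le] at a1 a2 a3 ⊢
    constructor <;> linarith [a1.1, a1.2, a2.1, a2.2, a3.1, a3.2]
  have e : ∫ z, h (√(n : ℝ) • σ z) ∂(stdGaussian (EuclideanSpace ℝ (Fin d))) =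
      gaussianSmoothing σ h n 0 := by simp [gaussianSmoothing]
  simp_rw [hsum]
  rw [e]
  rw [abs_le] at t1 t2 t3 ⊢
  constructor <;> linarith [t1.1, t1.2, t2.1, t2.2, t3.1, t3.2]

/-- The function x ↦ s h(x/s) is again 1-Lipschitz, so a bound over all such functions scales by
1/s. -/
theorem abs_integral_smul_sub_le {Ω : Type*} [MeasurableSpace Ω] {μ : Measure Ω} {E : Type*}
    [NormedAddCommGroup E] [NormedSpace ℝ E] [MeasurableSpace E] {ν : Measure E} {s b : ℝ}
    (hs : 0 < s) {U : Ω → E} {Z : E → E}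
    (H : ∀ h : E → ℝ, LipschitzWith 1 h → |∫ ω, h (U ω) ∂μ - ∫ z, h (s • Z z) ∂ν| ≤ b)
    {h : E → ℝ} (hh : LipschitzWith 1 h) :
    |∫ ω, h (s⁻¹ • U ω) ∂μ - ∫ z, h (Z z) ∂ν| ≤ b / s := by
  have hlip : LipschitzWith 1 fun x => s * h (s⁻¹ • x) := LipschitzWith.of_dist_le_mul fun x y => by
    have := hh.abs_sub_le_norm (s⁻¹ • x) (s⁻¹ • y)
    rw [← smul_sub, norm_smul, Real.norm_of_nonneg (by positivity), ← div_eq_inv_mul,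
      le_div_iff₀ hs] at this
    rw [Real.dist_eq, dist_eq_norm, ← mul_sub, abs_mul, abs_of_pos hs, NNReal.coe_one, one_mul]
    linarith
  have key := H _ hlip
  simp only [smul_smul, inv_mul_cancel₀ hs.ne', one_smul, integral_const_mul] at key
  rw [← mul_sub, abs_mul, abs_of_pos hs] at key
  rw [le_div_iff₀ hs]
  linarith

theorem hasMarkovCLTRate [DecidableEq S] [MeasurableSpace S]
    [MeasurableSingletonClass S] (hP : P ∈ Matrix.rowStochastic ℝ S) (hirr : P.IsIrreducible)
    (hπ : IsStationaryDistribution P π) (r : S → EuclideanSpace ℝ (Fin d)) :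
    HasMarkovCLTRate.{v, w} P π r := by
  obtain ⟨V, hV⟩ := exists_isPoissonSolution hP hirr hπ r
  obtain ⟨A, C, hA, hC, H⟩ := exists_abs_integral_sub_le_harmonic.{v, w} hP hirr hπ hV
  -- Since log n ≥ 1/2 for n ≥ 2, A + C(1 + log n) ≤ (2A + 3C) log n. The constants come from one
  -- fixed `V`, and any other solution has the same Σ_∞.
  refine ⟨⟨V, hV⟩, 2 * A + 3 * C, fun V' hV' Ω _ μ _ X hX n hn => ?_⟩
  rw [hV'.asympCov_eq hP hirr hV]
  refine iSup₂_le fun h hh => ENNReal.ofReal_le_ofReal ?_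
  have hn0 : (0 : ℝ) < n := by exact_mod_cast (by omega : 0 < n)
  have hmeas : Measurable (normalizedSum π r X n) := by
    have : Measurable fun ω => ∑ k ∈ Finset.range n, (r (X k ω) - finMean π r) :=
      Finset.measurable_sum _ fun k _ => ((measurable_of_countable r).comp (hX.1 k)).sub_const _
    exact this.const_smul (√(n : ℝ))⁻¹
  have hcont := hh.continuous
  rw [multivariateGaussian, integral_map hmeas.aemeasurable hcont.aestronglyMeasurable,
    integral_map (by fun_prop) hcont.aestronglyMeasurable]
  simp_rw [zero_add, normalizedSum]
  refine (le_abs_self _).trans ((abs_integral_smul_sub_le (Real.sqrt_pos.2 hn0)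
    (H Ω μ X hX n (by omega)) hh).trans ?_)
  rw [← mul_div_assoc]
  have h1 : (harmonic n : ℝ) ≤ 1 + Real.log n := harmonic_le_one_add_log n
  have h2 : 1 / 2 ≤ Real.log n := by
    have h3 : Real.log 2 ≤ Real.log n := Real.log_le_log (by norm_num) (by exact_mod_cast hn)
    linarith [Real.log_two_gt_d9]
  gcongr
  nlinarith [mul_le_mul_of_nonneg_left h1 hC, mul_nonneg hA (sub_nonneg.2 h2),
    mul_nonneg hC (sub_nonneg.2 h2)]

/-- The real part of 0 is not negative, so 0 is not an eigenvalue of -M and M is invertible. -/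
theorem IsHurwitz.existsUnique_toEuclideanLin_add_eq_zero {M : Matrix (Fin d) (Fin d) ℝ}
    (hM : IsHurwitz (-M)) (b : EuclideanSpace ℝ (Fin d)) :
    ∃! θ, Matrix.toEuclideanLin M θ + b = 0 := by
  have h0 : (0 : ℂ) ∉ spectrum ℂ ((-M).map (algebraMap ℝ ℂ)) := fun h => by
    simpa using hM 0 h
  rw [spectrum.zero_notMem_iff, Matrix.isUnit_iff_isUnit_det, isUnit_iff_ne_zero] at h0
  have hdet : IsUnit M.det := by
    rw [isUnit_iff_ne_zero]
    intro h
    apply h0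
    have h1 : (-M).det = 0 := by rw [Matrix.det_neg, h, mul_zero]
    rw [← RingHom.mapMatrix_apply, ← RingHom.map_det, h1, map_zero]
  refine ⟨Matrix.toEuclideanLin M⁻¹ (-b), ?_, fun θ hθ => ?_⟩
  · ext i
    simp [Matrix.toEuclideanLin, Matrix.mulVec_mulVec,
      Matrix.mul_nonsing_inv M hdet]
  · rw [← eq_neg_of_add_eq_zero_left hθ]
    ext i
    simp [Matrix.toEuclideanLin, Matrix.mulVec_mulVec, Matrix.nonsing_inv_mul M hdet]

end MarkovRate

theorem corollary1 {S : Type v} [Fintype S] [DecidableEq S] [MeasurableSpace S]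
    [MeasurableSingletonClass S] {d : ℕ}
    (P : Matrix S S ℝ) (hP : P ∈ Matrix.rowStochastic ℝ S)
    (hirr : P.IsIrreducible) (hap : IsAperiodic P)
    (π : S → ℝ) (hπ : IsStationaryDistribution P π) :
    (∀ r : S → EuclideanSpace ℝ (Fin d), HasMarkovCLTRate.{v, w} P π r) ∧
    ∀ (A : S → Matrix (Fin d) (Fin d) ℝ) (b : S → EuclideanSpace ℝ (Fin d)),
      IsHurwitz (-finMean π A) →
        (∃! θ, Matrix.toEuclideanLin (finMean π A) θ + finMean π b = 0) ∧
        ∀ θ, Matrix.toEuclideanLin (finMean π A) θ + finMean π b = 0 →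
          HasMarkovCLTRate.{v, w} P π (fun x => Matrix.toEuclideanLin (A x) θ + b x) :=
  ⟨fun r => hasMarkovCLTRate hP hirr hπ r, fun _ b hA =>
    ⟨hA.existsUnique_toEuclideanLin_add_eq_zero (finMean π b), fun _ _ =>
      hasMarkovCLTRate hP hirr hπ _⟩⟩
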